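/- Let $(X,d,\mu)$ be a space of homogeneous type: $X\neq\emptyset$; $d:X\times X\to[0,\infty)$ is a quasi-metric, i.e. $d(x,y)=0$ iff $x=y$, $d(x,y)=d(y,x)$, and $d(x,y)\le A_0(d(x,z)+d(z,y))$ for some constant $A_0\ge1$; and $\mu$ is a regular measure (every measurable set has measure equal to the infimum of the measures of the open sets containing it) on the $\sigma$-algebra generated by the open sets and the balls $B(x,r)=\{y:d(x,y)<r\}$, with $0<\mu(B(x,2r))\le C_\mu\,\mu(B(x,r))<\infty$ for all $x\in X$, $r>0$ and some constant $C_\mu\ge 1$. Fix $x_0\in X$. Let $m\in\mathbb N$, $\eta\in[0,m)$, and let $p_1(\cdot),\dots,p_m(\cdot):X\to[1,\infty)$ be measurable with $1<\operatorname{ess\,inf}p_i\le\operatorname{ess\,sup}p_i<\infty$ and globally log-Hölder continuous: for each $i$ there are $C,p_{i,\infty}\in\mathbb R$ with $$|p_i(x)-p_i(y)|\le\frac{C}{\log(e+1/d(x,y))}\ \text{ whenever } 0<d(x,y)<\tfrac12,\qquad |p_i(x)-p_{i,\infty}|\le\frac{C}{\log(e+d(x,x_0))}\ \text{ for all }x\in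 X.$$ Let $\frac1{p(\cdot)}=\sum_{i=1}^m\frac1{p_i(\cdot)}$ and $\frac1{p(\cdot)}-\frac1{q(\cdot)}=\eta$, where $q(\cdot)$ is measurable with $0<\operatorname{ess\,inf}q\le\operatorname{ess\,sup}q<\infty$. For a measurable function $f$ put $\|f\|_{p(\cdot)}=\inf\{\lambda>0:\int_X(|f(x)|/\lambda)^{p(x)}\,d\mu\le1\}$, $\|f\|_{L^{p(\cdot)}(X,\omega)}=\|\omega f\|_{p(\cdot)}$ and $\|g\|_{WL^{q(\cdot)}(X,\omega)}=\sup_{t>0}\|t\,\omega\,\chi_{\{|g|>t\}}\|_{q(\cdot)}$ (if the set $\{|g|>t\}$ is not measurable, it is replaced by a measurable hull). Let $$\mathscr M_\eta(\vec f)(x)=\sup_{B\ni x}\mu(B)^{\eta}\prod_{i=1}^m\frac1{\mu(B)}\int_B|f_i|\,d\mu,$$ the supremum being over all balls $B$ containing $x$. A weight is a measurable function $X\to[0,\infty]$ that is integrable on every ball and satisfies $0<\omega<\infty$ a.e. For weights $\omega_1,\dots,\omega_m$ put $\omega=\prod_{i=1}^m\omega_i$, $\vec\omega=(\omega_1,\dots,\omega_m,\omega)$,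 and $$[\vec\omega]_{A_{\vec p(\cdot),q(\cdot)}(X)}=\sup_{B}\mu(B)^{\eta-m}\|\omega\chi_B\|_{q(\cdot)}\prod_{i=1}^m\|\omega_i^{-1}\chi_B\|_{p_i'(\cdot)},\qquad p_i'(\cdot)=\frac{p_i(\cdot)}{p_i(\cdot)-1},$$ the supremum being over all balls; $\vec\omega\in A_{\vec p(\cdot),q(\cdot)}(X)$ means that this is finite. Then for all weights $\omega_1,\dots,\omega_m$, the operator $\mathscr M_\eta$ is bounded from $L^{p_1(\cdot)}(X,\omega_1)\times\cdots\times L^{p_m(\cdot)}(X,\omega_m)$ to $WL^{q(\cdot)}(X,\omega)$ if and only if $\vec\omega\in A_{\vec p(\cdot),q(\cdot)}(X)$. Moreover, there is a constant $C>0$, independent of $\vec\omega$, such that for all weights $\omega_1,\dots,\omega_m$ $$[\vec\omega]_{A_{\vec p(\cdot),q(\cdot)}(X)}\le C\,\|\mathscr M_\eta\|_{\prod_{i=1}^mL^{p_i(\cdot)}(X,\omega_i)\to WL^{q(\cdot)}(X,\omega)},$$ where the operator norm is the least admissible constant ($\infty$ if $\mathscr M_\eta$ is not bounded), and this operator norm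 is finite whenever $\vec\omega\in A_{\vec p(\cdot),q(\cdot)}(X)$. -/

import Mathlib

open MeasureTheory
open scoped ENNReal NNReal

noncomputable section

namespace VarWeights

/-- A quasi-metric on `X`. -/
structure QuasiMetric (X : Type*) where
  toFun : X → X → ℝ
  nonneg : ∀ x y, 0 ≤ toFun x y
  eq_zero_iff : ∀ x y, toFun x y = 0 ↔ x = y
  symm : ∀ x y, toFun x y = toFun y x
  quasi_triangle : ∃ A₀ : ℝ, 1 ≤ A₀ ∧
    ∀ x y z, toFun x y ≤ A₀ * (toFun x z + toFun z y)

variable {X : Type*}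

instance : CoeFun (QuasiMetric X) (fun _ => X → X → ℝ) := ⟨QuasiMetric.toFun⟩

/-- The quasi-metric ball `B(x, r) = {y : d(x, y) < r}`. -/
def QuasiMetric.ball (d : QuasiMetric X) (x : X) (r : ℝ) : Set X := {y | d x y < r}

/-- The topology induced by a quasi-metric: `U` is open when each of its points is the centre of
a ball contained in `U`. (Balls themselves need not be open.) -/
@[reducible] def QuasiMetric.topology (d : QuasiMetric X) : TopologicalSpace X where
  IsOpen U := ∀ x ∈ U, ∃ r : ℝ, 0 < r ∧ d.ball x r ⊆ U
  isOpen_univ := fun _ _ => ⟨1, one_pos, Set.subset_univ _⟩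
  isOpen_inter := by
    rintro U V hU hV x ⟨hxU, hxV⟩
    obtain ⟨r, hr, hrU⟩ := hU x hxU
    obtain ⟨s, hs, hsV⟩ := hV x hxV
    refine ⟨min r s, lt_min hr hs, fun y hy => ⟨hrU ?_, hsV ?_⟩⟩
    · exact lt_of_lt_of_le hy (min_le_left r s)
    · exact lt_of_lt_of_le hy (min_le_right r s)
  isOpen_sUnion := by
    rintro S hS x ⟨U, hU, hxU⟩
    obtain ⟨r, hr, hrU⟩ := hS U hU x hxU
    exact ⟨r, hr, hrU.trans (Set.subset_sUnion_of_mem hU)⟩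

/-- The `σ`-algebra generated by the open sets and the quasi-metric balls. -/
@[reducible] def QuasiMetric.sigmaAlgebra (d : QuasiMetric X) : MeasurableSpace X :=
  MeasurableSpace.generateFrom
    ({U | d.topology.IsOpen U} ∪ {B | ∃ (x : X) (r : ℝ), 0 < r ∧ B = d.ball x r})

/-- `(X, d, μ)` is a space of homogeneous type: `μ` is a regular doubling measure on the
`σ`-algebra generated by the open sets and the balls. Of regularity only the approximation of
measurable sets from outside by open sets is required, so that `X` need not be complete. -/
structure IsHomogeneousType [mX : MeasurableSpace X] (d : QuasiMetric X) (μ : Measure X) :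
    Prop where
  measurableSpace_eq : mX = d.sigmaAlgebra
  outer_regular : ∀ E : Set X, MeasurableSet E →
    μ E = ⨅ (U : Set X) (_ : d.topology.IsOpen U) (_ : E ⊆ U), μ U
  doubling : ∃ Cμ : ℝ≥0, 1 ≤ Cμ ∧ ∀ (x : X) (r : ℝ), 0 < r →
    0 < μ (d.ball x (2 * r)) ∧ μ (d.ball x (2 * r)) ≤ Cμ * μ (d.ball x r) ∧
      μ (d.ball x r) < ∞

section Exponents

variable [MeasurableSpace X]

/-- The class `𝒫` : measurable `p : X → [1, ∞)` with `1 < p₋ ≤ p₊ < ∞`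
(essential infimum and supremum). -/
structure IsExpP (μ : Measure X) (p : X → ℝ) : Prop where
  measurable : Measurable p
  one_le : ∀ x, 1 ≤ p x
  one_lt_essInf : 1 < essInf (fun x => ENNReal.ofReal (p x)) μ
  essSup_lt_top : essSup (fun x => ENNReal.ofReal (p x)) μ < ∞

/-- The class `𝒫₀` : measurable `p : X → [0, ∞)` with `0 < p₋ ≤ p₊ < ∞`. -/
structure IsExpP0 (μ : Measure X) (p : X → ℝ) : Prop where
  measurable : Measurable p
  nonneg : ∀ x, 0 ≤ p x
  essInf_pos : 0 < essInf (fun x => ENNReal.ofReal (p x)) μ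
  essSup_lt_top : essSup (fun x => ENNReal.ofReal (p x)) μ < ∞

end Exponents

/-- Local log-Hölder continuity `LH₀`. -/
def LH0 (d : QuasiMetric X) (p : X → ℝ) : Prop :=
  ∃ C : ℝ, ∀ x y : X, d x y < 1 / 2 →
    |p x - p y| ≤ C / Real.log (Real.exp 1 + 1 / d x y)

/-- Log-Hölder continuity at infinity `LH_∞`, with respect to the point `x₀`. -/
def LHInfty (d : QuasiMetric X) (x₀ : X) (p : X → ℝ) : Prop :=
  ∃ pInf C : ℝ, ∀ x : X, |p x - pInf| ≤ C / Real.log (Real.exp 1 + d x x₀)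

/-- Global log-Hölder continuity `LH = LH₀ ∩ LH_∞`. -/
def LH (d : QuasiMetric X) (x₀ : X) (p : X → ℝ) : Prop := LH0 d p ∧ LHInfty d x₀ p

variable [MeasurableSpace X]

/-- The Luxemburg (quasi-)norm `‖f‖_{p(·)} = inf {r > 0 : ∫ (f / r)^{p(x)} dμ ≤ 1}` of a function
with values in `[0, ∞]`, for an exponent that is finite almost everywhere; it is `∞` if there is
no such `r`. The norm `‖f χ_E‖_{p(·)}` is obtained as `luxNorm (μ.restrict E) p f`; when `E` is not
measurable this is `‖f χ_F‖_{p(·)}` for a measurable hull `F` of `E`. -/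
def luxNorm (μ : Measure X) (p : X → ℝ) (f : X → ℝ≥0∞) : ℝ≥0∞ :=
  sInf {r : ℝ≥0∞ | 0 < r ∧ r ≠ ∞ ∧ ∫⁻ x, (f x / r) ^ p x ∂μ ≤ 1}

/-- The norm `‖f‖_{L^{p(·)}(X, ω)} = ‖ω f‖_{p(·)}`. -/
def wNorm (μ : Measure X) (p : X → ℝ) (ω : X → ℝ≥0∞) (f : X → ℝ) : ℝ≥0∞ :=
  luxNorm μ p (fun x => ω x * ‖f x‖ₑ)

/-- Membership in `L^{p(·)}(X, ω)`. -/
def MemWLp (μ : Measure X) (p : X → ℝ) (ω : X → ℝ≥0∞) (f : X → ℝ) : Prop :=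
  AEMeasurable f μ ∧ wNorm μ p ω f < ∞

/-- The weak norm `‖g‖_{WL^{q(·)}(X, ω)} = sup_{t > 0} ‖t ω χ_{{g > t}}‖_{q(·)}`
of a function with values in `[0, ∞]`. The function `g` is not required to be measurable (a maximal
function over quasi-metric balls need not be): superlevel sets are measured from outside. -/
def weakNorm (μ : Measure X) (q : X → ℝ) (ω : X → ℝ≥0∞) (g : X → ℝ≥0∞) : ℝ≥0∞ :=
  ⨆ (t : ℝ≥0) (_ : 0 < t),
    luxNorm (μ.restrict {x | (t : ℝ≥0∞) < g x}) q (fun x => t * ω x)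

/-- A weight: a function with values in `[0, ∞]`, integrable on every ball, with
`0 < ω < ∞` almost everywhere. -/
structure IsWeight (d : QuasiMetric X) (μ : Measure X) (ω : X → ℝ≥0∞) : Prop where
  aemeasurable : AEMeasurable ω μ
  locally_integrable : ∀ (x : X) (r : ℝ), 0 < r → ∫⁻ y in d.ball x r, ω y ∂μ < ∞
  pos_finite : ∀ᵐ x ∂μ, 0 < ω x ∧ ω x < ∞

variable {m : ℕ}

/-- The multilinear fractional average `μ(B)^η ∏ᵢ ⟨|fᵢ|⟩_B` over a set `B`. -/
def fracAverage (μ : Measure X) (η : ℝ) (f : Fin m → X → ℝ) (B : Set X) : ℝ≥0∞ :=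
  μ B ^ η * ∏ i, ((μ B)⁻¹ * ∫⁻ y in B, ‖f i y‖ₑ ∂μ)

/-- The multilinear fractional maximal operator
`ℳ_η(f)(x) = sup_{B ∋ x} μ(B)^η ∏ᵢ ⟨|fᵢ|⟩_B`, over all balls `B` containing `x`. -/
def fracMaximal (d : QuasiMetric X) (μ : Measure X) (η : ℝ) (f : Fin m → X → ℝ) (x : X) :
    ℝ≥0∞ :=
  ⨆ (c : X) (r : ℝ) (_ : 0 < r) (_ : x ∈ d.ball c r), fracAverage μ η f (d.ball c r)

/-- The characteristic of the multiple weight `(ω₁, …, ω_m, ω)`: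
`sup_B μ(B)^{η - m} ‖ω χ_B‖_{q(·)} ∏ᵢ ‖ωᵢ⁻¹ χ_B‖_{pᵢ'(·)}`. -/
def weightChar (d : QuasiMetric X) (μ : Measure X) (η : ℝ) (p : Fin m → X → ℝ) (q : X → ℝ)
    (ω : Fin m → X → ℝ≥0∞) (ω₀ : X → ℝ≥0∞) : ℝ≥0∞ :=
  ⨆ (c : X) (r : ℝ) (_ : 0 < r),
    μ (d.ball c r) ^ (η - (m : ℝ)) * luxNorm (μ.restrict (d.ball c r)) q ω₀ *
      ∏ i, luxNorm (μ.restrict (d.ball c r)) (fun x => Real.conjExponent (p i x))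
        (fun x => (ω i x)⁻¹)

/-- Membership of `(ω₁, …, ω_m, ω)` in the class `A_{p(·), q(·)}(X)`. -/
def MemA (d : QuasiMetric X) (μ : Measure X) (η : ℝ) (p : Fin m → X → ℝ) (q : X → ℝ)
    (ω : Fin m → X → ℝ≥0∞) (ω₀ : X → ℝ≥0∞) : Prop :=
  weightChar d μ η p q ω ω₀ < ∞

/-- `ℳ_η` maps `∏ᵢ L^{pᵢ(·)}(X, ωᵢ)` to `WL^{q(·)}(X, ω)` with constant `C`. -/
def WeakBoundWith (d : QuasiMetric X) (μ : Measure X) (η : ℝ) (p : Fin m → X → ℝ) (q : X → ℝ)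
    (ω : Fin m → X → ℝ≥0∞) (ω₀ : X → ℝ≥0∞) (C : ℝ≥0) : Prop :=
  ∀ f : Fin m → X → ℝ, (∀ i, MemWLp μ (p i) (ω i) (f i)) →
    weakNorm μ q ω₀ (fracMaximal d μ η f) ≤ C * ∏ i, wNorm μ (p i) (ω i) (f i)

/-- `ℳ_η` is bounded from `∏ᵢ L^{pᵢ(·)}(X, ωᵢ)` to `WL^{q(·)}(X, ω)`. -/
def WeakBounded (d : QuasiMetric X) (μ : Measure X) (η : ℝ) (p : Fin m → X → ℝ) (q : X → ℝ)
    (ω : Fin m → X → ℝ≥0∞) (ω₀ : X → ℝ≥0∞) : Prop :=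
  ∃ C : ℝ≥0, WeakBoundWith d μ η p q ω ω₀ C

/-- The weak-type operator norm of `ℳ_η`: the infimum of the admissible constants
(`∞` if there is none). -/
def weakOpNorm (d : QuasiMetric X) (μ : Measure X) (η : ℝ) (p : Fin m → X → ℝ) (q : X → ℝ)
    (ω : Fin m → X → ℝ≥0∞) (ω₀ : X → ℝ≥0∞) : ℝ≥0∞ :=
  ⨅ (C : ℝ≥0) (_ : WeakBoundWith d μ η p q ω ω₀ C), (C : ℝ≥0∞)

end VarWeights

end

open VarWeights

namespace VarWeights

section Luxemburg

variable {X : Type*} [MeasurableSpace X] {μ ν : Measure X} {p : X → ℝ} {f : X → ℝ≥0∞}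

theorem luxNorm_mono_measure (h : μ ≤ ν) : luxNorm μ p f ≤ luxNorm ν p f :=
  sInf_le_sInf fun _ hr => ⟨hr.1, hr.2.1, (lintegral_mono' h le_rfl).trans hr.2.2⟩

theorem luxNorm_le_of_modular_le_one {r : ℝ≥0∞} (h0 : r ≠ 0) (ht : r ≠ ∞)
    (h : ∫⁻ x, (f x / r) ^ p x ∂μ ≤ 1) : luxNorm μ p f ≤ r :=
  sInf_le ⟨h0.bot_lt, ht, h⟩

theorem modular_le_one_of_luxNorm_lt (hp : ∀ᵐ x ∂μ, 0 ≤ p x) {r : ℝ≥0∞}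
    (h : luxNorm μ p f < r) : ∫⁻ x, (f x / r) ^ p x ∂μ ≤ 1 := by
  obtain ⟨s, hs, hsr⟩ := sInf_lt_iff.1 h
  refine (lintegral_mono_ae ?_).trans hs.2.2
  filter_upwards [hp] with x hx
  exact ENNReal.rpow_le_rpow (by gcongr) hx

theorem one_lt_modular_of_lt_luxNorm {r : ℝ≥0∞} (h0 : r ≠ 0) (h : r < luxNorm μ p f) :
    1 < ∫⁻ x, (f x / r) ^ p x ∂μ := by
  by_contra hc
  exact absurd (luxNorm_le_of_modular_le_one h0 h.ne_top (not_lt.1 hc)) (not_le.2 h)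

theorem luxNorm_const_mul_le {c : ℝ≥0∞} (h0 : c ≠ 0) (ht : c ≠ ∞) :
    luxNorm μ p (fun x => c * f x) ≤ c * luxNorm μ p f := by
  rw [mul_comm, ← ENNReal.div_le_iff h0 ht]
  refine le_sInf fun r hr => ?_
  rw [ENNReal.div_le_iff h0 ht]
  refine luxNorm_le_of_modular_le_one (mul_ne_zero hr.1.ne' h0) (ENNReal.mul_ne_top hr.2.1 ht) ?_
  refine le_trans (le_of_eq ?_) hr.2.2
  congr 1 with x
  rw [mul_comm r c, ENNReal.mul_div_mul_left _ _ h0 ht]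

theorem luxNorm_const_mul {c : ℝ≥0∞} (h0 : c ≠ 0) (ht : c ≠ ∞) :
    luxNorm μ p (fun x => c * f x) = c * luxNorm μ p f := by
  refine le_antisymm (luxNorm_const_mul_le h0 ht) ?_
  have h := luxNorm_const_mul_le (μ := μ) (p := p) (f := fun x => c * f x)
    (ENNReal.inv_ne_zero.2 ht) (ENNReal.inv_ne_top.2 h0)
  simp only [← mul_assoc, ENNReal.inv_mul_cancel h0 ht, one_mul] at h
  calc c * luxNorm μ p f ≤ c * (c⁻¹ * luxNorm μ p (fun x => c * f x)) := by gcongr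
    _ = _ := by rw [← mul_assoc, ENNReal.mul_inv_cancel h0 ht, one_mul]

theorem luxNorm_pos (hμ : μ ≠ 0) (hp : Measurable p) (hp0 : ∀ᵐ x ∂μ, 0 < p x)
    (hf : AEMeasurable f μ) (hf0 : ∀ᵐ x ∂μ, 0 < f x) : 0 < luxNorm μ p f := by
  rw [pos_iff_ne_zero]
  intro h
  have hle : ∀ n : ℕ, ∫⁻ x, (f x / (n + 1 : ℝ≥0∞)⁻¹) ^ p x ∂μ ≤ 1 := fun n =>
    modular_le_one_of_luxNorm_lt (hp0.mono fun x hx => hx.le)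
      (h ▸ ENNReal.inv_pos.2 (by finiteness))
  have hF := lintegral_liminf_le' (μ := μ) (u := Filter.atTop)
    (f := fun (n : ℕ) x => (f x / (n + 1 : ℝ≥0∞)⁻¹) ^ p x)
    (fun n => (hf.div_const _).pow hp.aemeasurable)
  have htop : ∫⁻ x, Filter.liminf (fun n : ℕ => (f x / (n + 1 : ℝ≥0∞)⁻¹) ^ p x) Filter.atTop ∂μ
      = ∞ := by
    rw [lintegral_congr_ae (g := fun _ => ∞)]
    · simp [hμ]
    · filter_upwards [hp0, hf0] with x hx hfx
      refine Filter.Tendsto.liminf_eq ?_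
      have h1 : Filter.Tendsto (fun n : ℕ => f x / (n + 1 : ℝ≥0∞)⁻¹) Filter.atTop (nhds ∞) := by
        have h2 : Filter.Tendsto (fun n : ℕ => f x * ((n + 1 : ℕ) : ℝ≥0∞)) Filter.atTop
            (nhds (f x * ∞)) :=
          ENNReal.Tendsto.const_mul
            (ENNReal.tendsto_nat_nhds_top.comp (Filter.tendsto_add_atTop_nat 1)) (Or.inl (by simp))
        rw [ENNReal.mul_top hfx.ne'] at h2
        refine h2.congr fun n => ?_
        simp [div_eq_mul_inv]
      have h3 := ((ENNReal.continuous_rpow_const (y := p x)).tendsto ∞).comp h1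
      rwa [ENNReal.top_rpow_of_pos hx] at h3
  rw [htop] at hF
  have : Filter.liminf (fun n : ℕ => ∫⁻ x, (f x / (n + 1 : ℝ≥0∞)⁻¹) ^ p x ∂μ) Filter.atTop ≤ 1 :=
    (Filter.liminf_le_liminf (Filter.Eventually.of_forall hle)).trans (by simp)
  exact absurd (hF.trans this) (by simp)

end Luxemburg

section Holder

theorem prod_rpow_le_sup_rpow {ι : Type*} (s : Finset ι) (a : ι → ℝ≥0∞) (θ : ι → ℝ)
    (hθ : ∀ i ∈ s, 0 ≤ θ i) : ∏ i ∈ s, a i ^ θ i ≤ (s.sup a) ^ (∑ i ∈ s, θ i) := by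
  have key : ∀ t ⊆ s, ∏ i ∈ t, s.sup a ^ θ i = s.sup a ^ (∑ i ∈ t, θ i) := by
    classical
    intro t
    induction t using Finset.induction_on with
    | empty => simp
    | insert i t hi ih =>
      intro hts
      rw [Finset.prod_insert hi, Finset.sum_insert hi, ih (fun j hj => hts (by simp [hj])),
        ENNReal.rpow_add_of_nonneg _ _ (hθ i (hts (by simp)))
          (Finset.sum_nonneg fun j hj => hθ j (hts (by simp [hj])))]
  rw [← key s subset_rfl]
  exact Finset.prod_le_prod' fun i hi => ENNReal.rpow_le_rpow (Finset.le_sup hi) (hθ i hi)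

theorem sup_le_sum_ennreal {ι : Type*} (s : Finset ι) (a : ι → ℝ≥0∞) :
    s.sup a ≤ ∑ i ∈ s, a i :=
  Finset.sup_le fun _ hi => Finset.single_le_sum_of_canonicallyOrdered hi

/-- Products are bounded by sums of powers: the case of harmonic exponents summing to `1 / s`. -/
theorem prod_rpow_le_sum_rpow {ι : Type*} [Fintype ι] {s : ℝ} (hs : 0 < s) (r : ι → ℝ)
    (hr : ∀ i, 0 < r i) (hsum : ∑ i, 1 / r i = 1 / s) (c : ι → ℝ≥0∞) :
    ∏ i, c i ^ s ≤ ∑ i, c i ^ r i := by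
  have h := prod_rpow_le_sup_rpow Finset.univ (fun i => c i ^ r i) (fun i => s / r i)
    (fun i _ => (div_pos hs (hr i)).le)
  have h1 : ∑ i, s / r i = 1 := by
    have : ∑ i, s / r i = s * ∑ i, 1 / r i := by
      rw [Finset.mul_sum]; simp [div_eq_mul_inv]
    rw [this, hsum, mul_one_div_cancel hs.ne']
  rw [h1, ENNReal.rpow_one] at h
  refine le_trans (le_of_eq (Finset.prod_congr rfl fun i _ => ?_)) (h.trans (sup_le_sum_ennreal _ _))
  rw [← ENNReal.rpow_mul, mul_div_cancel₀ _ (hr i).ne']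

theorem prod_rpow_le_sum_rpow_of_le_one {ι : Type*} [Fintype ι] {s : ℝ} (hs : 0 < s) (r : ι → ℝ)
    (hr : ∀ i, 0 < r i) (hsum : 1 / s ≤ ∑ i, 1 / r i) (c : ι → ℝ≥0∞) (hc : ∀ i, c i ≤ 1) :
    (∏ i, c i) ^ s ≤ ∑ i, c i ^ r i := by
  have h := prod_rpow_le_sup_rpow Finset.univ (fun i => c i ^ r i) (fun i => s / r i)
    (fun i _ => (div_pos hs (hr i)).le)
  have h1 : 1 ≤ ∑ i, s / r i := by
    have : ∑ i, s / r i = s * ∑ i, 1 / r i := by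
      rw [Finset.mul_sum]; simp [div_eq_mul_inv]
    rw [this]
    calc (1 : ℝ) = s * (1 / s) := by rw [mul_one_div_cancel hs.ne']
      _ ≤ _ := by gcongr
  have h2 : (Finset.univ.sup fun i => c i ^ r i) ≤ 1 :=
    Finset.sup_le fun i _ => ENNReal.rpow_le_one (hc i) (hr i).le
  rw [← ENNReal.prod_rpow_of_nonneg hs.le]
  calc ∏ i, c i ^ s = ∏ i, (c i ^ r i) ^ (s / r i) := Finset.prod_congr rfl fun i _ => by
        rw [← ENNReal.rpow_mul, mul_div_cancel₀ _ (hr i).ne']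
    _ ≤ _ := h
    _ ≤ (Finset.univ.sup fun i => c i ^ r i) ^ (1 : ℝ) := ENNReal.rpow_le_rpow_of_exponent_ge h2 h1
    _ ≤ _ := by rw [ENNReal.rpow_one]; exact sup_le_sum_ennreal _ _

variable {X : Type*} [MeasurableSpace X] {μ : Measure X}

/-- Hölder's inequality for variable exponents whose harmonic sum is constant. -/
theorem lintegral_prod_rpow_le_card {ι : Type*} [Fintype ι] {s : ℝ} (hs : 0 < s)
    (r : ι → X → ℝ) (hrm : ∀ i, Measurable (r i)) (hr : ∀ i, ∀ᵐ x ∂μ, 0 < r i x)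
    (hsum : ∀ᵐ x ∂μ, ∑ i, 1 / r i x = 1 / s) (h : ι → X → ℝ≥0∞)
    (hm : ∀ i, AEMeasurable (h i) μ) (a : ι → ℝ≥0∞)
    (ha : ∀ i, ∫⁻ x, (h i x / a i) ^ r i x ∂μ ≤ 1) :
    ∫⁻ x, ∏ i, (h i x / a i) ^ s ∂μ ≤ Fintype.card ι := by
  calc ∫⁻ x, ∏ i, (h i x / a i) ^ s ∂μ ≤ ∫⁻ x, ∑ i, (h i x / a i) ^ r i x ∂μ := by
        refine lintegral_mono_ae ?_
        filter_upwards [hsum, ae_all_iff.2 hr] with x hx hrx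
        exact prod_rpow_le_sum_rpow hs (fun i => r i x) hrx hx _
    _ = ∑ i, ∫⁻ x, (h i x / a i) ^ r i x ∂μ :=
        lintegral_finsetSum' _ fun i _ => ((hm i).div_const _).pow (hrm i).aemeasurable
    _ ≤ ∑ _i : ι, 1 := Finset.sum_le_sum fun i _ => ha i
    _ = _ := by simp

theorem lintegral_mul_le_luxNorm_mul_luxNorm {r r' : X → ℝ} (hrm : Measurable r)
    (hrm' : Measurable r') (hr : ∀ᵐ x ∂μ, 0 < r x) (hr' : ∀ᵐ x ∂μ, 0 < r' x)
    (hsum : ∀ᵐ x ∂μ, 1 / r x + 1 / r' x = 1) {f g : X → ℝ≥0∞}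
    (hf : AEMeasurable f μ) (hg : AEMeasurable g μ) (hg0 : luxNorm μ r' g ≠ 0)
    (hgt : luxNorm μ r' g ≠ ∞) :
    ∫⁻ x, f x * g x ∂μ ≤ 2 * (luxNorm μ r f * luxNorm μ r' g) := by
  suffices h : (∫⁻ x, f x * g x ∂μ) / 2 ≤ luxNorm μ r f * luxNorm μ r' g by
    rw [mul_comm]
    exact (ENNReal.div_le_iff (by simp) (by simp)).1 h
  refine ENNReal.le_mul_of_forall_lt (Or.inr hgt) (Or.inr hg0) fun a ha b hb => ?_
  have ha0 : a ≠ 0 := (bot_le.trans_lt ha).ne'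
  have hb0 : b ≠ 0 := (bot_le.trans_lt hb).ne'
  by_cases hat : a = ∞
  · simp [hat, hb0]
  by_cases hbt : b = ∞
  · simp [hbt, ha0]
  have h := lintegral_prod_rpow_le_card (μ := μ) (ι := Fin 2) (s := 1) one_pos ![r, r']
    (by intro i; fin_cases i <;> simpa) (by intro i; fin_cases i <;> simpa)
    (by simpa [Fin.sum_univ_two] using hsum) ![f, g] (by intro i; fin_cases i <;> simpa)
    ![a, b] (by
      intro i
      fin_cases i
      · exact modular_le_one_of_luxNorm_lt (hr.mono fun x hx => hx.le) ha
      · exact modular_le_one_of_luxNorm_lt (hr'.mono fun x hx => hx.le) hb)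
  simp only [ENNReal.rpow_one, Fin.prod_univ_two, Matrix.cons_val_zero, Matrix.cons_val_one,
    Fintype.card_fin, Nat.cast_ofNat] at h
  have h2 : ∀ x, f x / a * (g x / b) = (f x * g x) * (a * b)⁻¹ := fun x => by
    rw [ENNReal.mul_inv (Or.inl ha0) (Or.inl hat)]; simp only [div_eq_mul_inv]; ring
  have hab : (a * b)⁻¹ ≠ ∞ := ENNReal.inv_ne_top.2 (mul_ne_zero ha0 hb0)
  simp only [h2] at h
  rw [lintegral_mul_const' _ _ hab, ← div_eq_mul_inv,
    ENNReal.div_le_iff (mul_ne_zero ha0 hb0) (ENNReal.mul_ne_top hat hbt)] at h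
  rw [ENNReal.div_le_iff (by simp) (by simp), mul_comm]
  exact h

end Holder

section Geometry

variable {X : Type*} {d : QuasiMetric X}

theorem QuasiMetric.self_eq_zero (d : QuasiMetric X) (x : X) : d x x = 0 :=
  (d.eq_zero_iff x x).2 rfl

theorem QuasiMetric.mem_ball_self (d : QuasiMetric X) (x : X) {r : ℝ} (hr : 0 < r) :
    x ∈ d.ball x r := by
  simpa [QuasiMetric.ball, d.self_eq_zero] using hr

theorem QuasiMetric.ball_subset_ball (d : QuasiMetric X) (x : X) {r s : ℝ} (h : r ≤ s) :
    d.ball x r ⊆ d.ball x s := fun _ hy => lt_of_lt_of_le hy h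

section Measure

variable [mX : MeasurableSpace X] {μ : Measure X}

theorem IsHomogeneousType.measurableSet_ball (hX : IsHomogeneousType d μ) (x : X) {r : ℝ}
    (hr : 0 < r) : MeasurableSet (d.ball x r) := by
  have h : MeasurableSet[d.sigmaAlgebra] (d.ball x r) :=
    MeasurableSpace.measurableSet_generateFrom (Or.inr ⟨x, r, hr, rfl⟩)
  rw [hX.measurableSpace_eq]
  exact h

theorem IsHomogeneousType.measure_ball_pos (hX : IsHomogeneousType d μ) (x : X) {r : ℝ}
    (hr : 0 < r) : 0 < μ (d.ball x r) := by
  obtain ⟨C, -, h⟩ := hX.doubling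
  have := (h x (r / 2) (by positivity)).1
  rwa [mul_div_cancel₀ _ two_ne_zero] at this

theorem IsHomogeneousType.measure_ball_lt_top (hX : IsHomogeneousType d μ) (x : X) {r : ℝ}
    (hr : 0 < r) : μ (d.ball x r) < ∞ := by
  obtain ⟨C, -, h⟩ := hX.doubling
  exact (h x r hr).2.2

theorem IsHomogeneousType.exists_measure_ball_le_pow (hX : IsHomogeneousType d μ) :
    ∃ L : ℕ, ∀ (x : X) (r l : ℝ), 0 < r → 1 ≤ l →
      μ (d.ball x (l * r)) ≤ ENNReal.ofReal ((2 * l) ^ L) * μ (d.ball x r) := by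
  obtain ⟨C, -, h⟩ := hX.doubling
  obtain ⟨L, hL⟩ := pow_unbounded_of_one_lt (C : ℝ) one_lt_two
  have hC : (C : ℝ≥0∞) ≤ ENNReal.ofReal (2 ^ L) := by
    rw [← ENNReal.ofReal_coe_nnreal]
    exact ENNReal.ofReal_le_ofReal hL.le
  have hk : ∀ (k : ℕ) (x : X) (r : ℝ), 0 < r →
      μ (d.ball x (2 ^ k * r)) ≤ ENNReal.ofReal ((2 ^ k) ^ L) * μ (d.ball x r) := by
    intro k x r hr
    induction k with
    | zero => simp
    | succ k ih =>
      calc μ (d.ball x (2 ^ (k + 1) * r)) = μ (d.ball x (2 * (2 ^ k * r))) := by ring_nf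
        _ ≤ C * μ (d.ball x (2 ^ k * r)) := (h x (2 ^ k * r) (by positivity)).2.1
        _ ≤ ENNReal.ofReal (2 ^ L) * (ENNReal.ofReal ((2 ^ k) ^ L) * μ (d.ball x r)) := by gcongr
        _ = _ := by
          rw [← mul_assoc, ← ENNReal.ofReal_mul (by positivity)]
          congr 2
          ring
  refine ⟨L, fun x r l hr hl => ?_⟩
  obtain ⟨k, hk1, hk2⟩ := exists_nat_pow_near hl one_lt_two
  refine (measure_mono (d.ball_subset_ball x ?_)).trans ((hk (k + 1) x r hr).trans ?_)
  · gcongr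
  · gcongr
    rw [pow_succ, mul_comm]
    gcongr

theorem IsHomogeneousType.sigmaFinite (hX : IsHomogeneousType d μ) (x₀ : X) : SigmaFinite μ :=
  ⟨⟨{ set := fun n => d.ball x₀ (n + 1)
      set_mem := fun _ => trivial
      finite := fun n => hX.measure_ball_lt_top x₀ (by positivity)
      spanning := by
        refine Set.eq_univ_of_forall fun x => Set.mem_iUnion.2 ?_
        obtain ⟨n, hn⟩ := exists_nat_gt (d x₀ x)
        exact ⟨n, show d x₀ x < n + 1 by linarith⟩ }⟩⟩

/-- There is an integrable function that decays polynomially at infinity. -/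
theorem IsHomogeneousType.exists_integrable_decay (hX : IsHomogeneousType d μ) (x₀ : X) :
    ∃ (K : ℕ) (g : X → ℝ≥0∞), Measurable g ∧ ∫⁻ x, g x ∂μ < ∞ ∧
      ∀ (x : X) (s : ℝ), 1 ≤ s → d x₀ x < s → ENNReal.ofReal ((1 / (2 * s)) ^ K) ≤ g x := by
  obtain ⟨L, hL⟩ := hX.exists_measure_ball_le_pow
  let g : X → ℝ≥0∞ := fun x => ∑' k : ℕ,
    (d.ball x₀ (2 ^ k)).indicator (fun _ => ENNReal.ofReal ((1 / 2 ^ k) ^ (L + 1))) x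
  have hmeas : ∀ k : ℕ, MeasurableSet (d.ball x₀ (2 ^ k)) := fun k =>
    hX.measurableSet_ball x₀ (by positivity)
  refine ⟨L + 1, g, ?_, ?_, ?_⟩
  · exact Measurable.tsum fun k => measurable_const.indicator (hmeas k)
  · rw [lintegral_tsum fun k => (measurable_const.indicator (hmeas k)).aemeasurable]
    have hk : ∀ k : ℕ, ∫⁻ x, (d.ball x₀ (2 ^ k)).indicator
        (fun _ => ENNReal.ofReal ((1 / 2 ^ k) ^ (L + 1))) x ∂μ ≤
        (ENNReal.ofReal (2 ^ L) * μ (d.ball x₀ 1)) * 2⁻¹ ^ k := by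
      intro k
      rw [lintegral_indicator_const (hmeas k)]
      have h1 := hL x₀ 1 (2 ^ k) one_pos (one_le_pow₀ one_le_two)
      rw [mul_one] at h1
      have h2 : (2⁻¹ : ℝ≥0∞) ^ k = ENNReal.ofReal ((1 / 2) ^ k) := by
        rw [ENNReal.ofReal_pow (by norm_num)]
        congr 1
        rw [one_div, ENNReal.ofReal_inv_of_pos two_pos]
        simp
      calc _ ≤ ENNReal.ofReal ((1 / 2 ^ k) ^ (L + 1)) *
            (ENNReal.ofReal ((2 * 2 ^ k) ^ L) * μ (d.ball x₀ 1)) := by gcongr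
        _ = ENNReal.ofReal ((1 / 2 ^ k) ^ (L + 1) * (2 * 2 ^ k) ^ L) * μ (d.ball x₀ 1) := by
          rw [ENNReal.ofReal_mul (by positivity), mul_assoc]
        _ = ENNReal.ofReal (2 ^ L * (1 / 2) ^ k) * μ (d.ball x₀ 1) := by
          congr 2
          rw [mul_pow, pow_succ, one_div_pow, one_div_pow]
          field_simp
        _ = _ := by
          rw [ENNReal.ofReal_mul (by positivity), h2]
          ring
    refine (ENNReal.tsum_le_tsum hk).trans_lt ?_
    rw [ENNReal.tsum_mul_left, ENNReal.tsum_geometric]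
    have := hX.measure_ball_lt_top x₀ one_pos
    refine ENNReal.mul_lt_top (ENNReal.mul_lt_top (by simp) this) ?_
    simp
  · intro x s hs hxs
    obtain ⟨k, hk1, hk2⟩ := exists_nat_pow_near hs one_lt_two
    refine le_trans ?_ (ENNReal.le_tsum (k + 1))
    have hmem : x ∈ d.ball x₀ (2 ^ (k + 1)) := hxs.trans hk2
    rw [Set.indicator_of_mem hmem]
    gcongr
    rw [pow_succ, mul_comm]
    gcongr

end Measure

/-- The scale of a ball relative to the base point. -/
noncomputable def ballScale (d : QuasiMetric X) (x₀ c : X) (r : ℝ) : ℝ := min r 1 / (Real.exp 1 + d c x₀)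

theorem ballScale_pos (x₀ c : X) {r : ℝ} (hr : 0 < r) : 0 < ballScale d x₀ c r :=
  div_pos (lt_min hr one_pos) (add_pos_of_pos_of_nonneg (Real.exp_pos 1) (d.nonneg _ _))

theorem one_le_exp_add (x y : X) : 1 ≤ Real.exp 1 + d x y := by
  have := d.nonneg x y
  have := Real.add_one_le_exp (1 : ℝ)
  linarith

theorem ballScale_le_one (x₀ c : X) (r : ℝ) : ballScale d x₀ c r ≤ 1 := by
  rw [ballScale, div_le_one (lt_of_lt_of_le one_pos (one_le_exp_add _ _))]
  exact (min_le_right _ _).trans (one_le_exp_add _ _)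

theorem le_dist_of_noncentral {A κ : ℝ} (hA : 1 ≤ A)
    (htri : ∀ x y z, d x y ≤ A * (d x z + d z y)) {x₀ c x : X} {r : ℝ}
    (hnc : 2 * A * κ * r ≤ d c x₀) (hx : x ∈ d.ball c (κ * r)) : d c x₀ ≤ 2 * A * d x x₀ := by
  have h1 := htri c x₀ x
  have h2 : d c x < κ * r := hx
  nlinarith

theorem one_le_log_exp_add {t : ℝ} (ht : 0 ≤ t) : 1 ≤ Real.log (Real.exp 1 + t) := by
  rw [Real.le_log_iff_exp_le (by positivity)]
  linarith

theorem log_exp_add_le {K s t : ℝ} (hK : 1 ≤ K) (hs : 0 ≤ s) (ht : 0 ≤ t) (h : s ≤ K * t) :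
    Real.log (Real.exp 1 + s) ≤ (1 + Real.log K) * Real.log (Real.exp 1 + t) := by
  have h1 := one_le_log_exp_add ht
  have hK0 := Real.log_nonneg hK
  have he := Real.exp_pos 1
  calc Real.log (Real.exp 1 + s) ≤ Real.log (K * (Real.exp 1 + t)) := by
        refine Real.log_le_log (by positivity) ?_
        nlinarith
    _ = Real.log K + Real.log (Real.exp 1 + t) := by
        rw [Real.log_mul (by positivity) (by positivity)]
    _ ≤ _ := by nlinarith

/-- On dilates of balls far from the base point a log-Hölder exponent oscillates by at most a
constant over the logarithm of the scale. -/
theorem LH.exists_osc_le {p : X → ℝ} {x₀ : X} (hp : LH d x₀ p) {A κ : ℝ} (hA : 1 ≤ A) (hκ : 1 ≤ κ)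
    (htri : ∀ x y z, d x y ≤ A * (d x z + d z y)) :
    ∃ K : ℝ, 0 ≤ K ∧ ∀ (c : X) (r : ℝ), 0 < r → 2 * A * κ * r ≤ d c x₀ →
      ∀ x ∈ d.ball c (κ * r), ∀ y ∈ d.ball c (κ * r),
        |p x - p y| * Real.log (1 / ballScale d x₀ c r) ≤ K := by
  obtain ⟨⟨C₀, hC₀⟩, ⟨pInf, C₁, hC₁⟩⟩ := hp
  have hC₀n : 0 ≤ C₀ := by
    have h := hC₀ x₀ x₀ (by rw [d.self_eq_zero]; norm_num)
    simpa [d.self_eq_zero] using h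
  have hC₁n : 0 ≤ C₁ := by
    have h := (abs_nonneg _).trans (hC₁ x₀)
    simpa [d.self_eq_zero] using h
  have hosc : ∀ x y : X, |p x - p y| ≤ 2 * C₁ := by
    intro x y
    have hb : ∀ z, |p z - pInf| ≤ C₁ := fun z =>
      (hC₁ z).trans (div_le_self hC₁n (one_le_log_exp_add (d.nonneg _ _)))
    have := abs_sub_le (p x) pInf (p y)
    have h1 := hb x
    have h2 := hb y
    rw [abs_sub_comm] at h2
    linarith
  set D : ℝ := 2 * A * κ with hD
  have hD1 : 1 ≤ D := by nlinarith
  have hlD := Real.log_nonneg hD1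
  have hlA := Real.log_nonneg (show 1 ≤ 2 * A by linarith)
  have hl2D := Real.log_nonneg (show 1 ≤ 2 * D by linarith)
  refine ⟨2 * C₁ * (1 + Real.log (2 * A)) +
    (C₀ * (1 + Real.log D) + 2 * C₁ * Real.log (2 * D)), by positivity, ?_⟩
  intro c r hr hnc x hx y hy
  have hlog : Real.log (1 / ballScale d x₀ c r) =
      Real.log (Real.exp 1 + d c x₀) + Real.log (1 / min r 1) := by
    have h1 : 0 < min r 1 := lt_min hr one_pos
    have h2 : 0 < Real.exp 1 + d c x₀ := lt_of_lt_of_le one_pos (one_le_exp_add _ _)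
    rw [ballScale, one_div_div, div_eq_mul_one_div, Real.log_mul h2.ne' (by positivity)]
  rw [hlog, mul_add]
  refine add_le_add ?_ ?_
  · have key : ∀ z ∈ d.ball c (κ * r),
        |p z - pInf| * Real.log (Real.exp 1 + d c x₀) ≤ C₁ * (1 + Real.log (2 * A)) := by
      intro z hz
      have h1 := one_le_log_exp_add (d.nonneg z x₀)
      have h2 := log_exp_add_le (by linarith) (d.nonneg c x₀) (d.nonneg z x₀)
        (le_dist_of_noncentral hA htri hnc hz)
      have h3 := hC₁ z
      rw [le_div_iff₀ (by linarith)] at h3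
      calc _ ≤ |p z - pInf| * ((1 + Real.log (2 * A)) * Real.log (Real.exp 1 + d z x₀)) := by
            gcongr
        _ = (|p z - pInf| * Real.log (Real.exp 1 + d z x₀)) * (1 + Real.log (2 * A)) := by ring
        _ ≤ _ := by gcongr
    have h1 := key x hx
    have h2 := key y hy
    rw [abs_sub_comm] at h2
    have h3 := abs_sub_le (p x) pInf (p y)
    have h4 := one_le_log_exp_add (d.nonneg c x₀)
    calc _ ≤ (|p x - pInf| + |pInf - p y|) * Real.log (Real.exp 1 + d c x₀) := by gcongr
      _ ≤ _ := by linarith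
  · rcases le_or_gt 1 r with h1 | h1
    · rw [min_eq_right h1]
      simp only [div_one, Real.log_one, mul_zero]
      positivity
    rw [min_eq_left h1.le]
    have hdxy : d x y ≤ D * r := by
      have h2 := htri x y c
      have h3 : d c x < κ * r := hx
      have h4 : d c y < κ * r := hy
      rw [d.symm x c] at h2
      nlinarith
    rcases eq_or_ne x y with rfl | hxy
    · simp only [sub_self, abs_zero, zero_mul]
      positivity
    have hd0 : 0 < d x y := lt_of_le_of_ne (d.nonneg _ _) fun h => hxy ((d.eq_zero_iff _ _).1 h.symm)
    rcases lt_or_ge (d x y) (1 / 2) with h2 | h2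
    · have h3 := hC₀ x y h2
      have h4 := one_le_log_exp_add (one_div_pos.2 hd0).le
      rw [le_div_iff₀ (by linarith)] at h3
      have h5 : Real.log (1 / r) ≤ (1 + Real.log D) * Real.log (Real.exp 1 + 1 / d x y) := by
        refine le_trans (Real.log_le_log (by positivity) ?_)
          (log_exp_add_le hD1 (one_div_pos.2 hr).le (one_div_pos.2 hd0).le ?_)
        · have := Real.exp_pos 1
          linarith
        · rw [mul_one_div, div_le_div_iff₀ hr hd0]
          linarith
      calc _ ≤ |p x - p y| * ((1 + Real.log D) * Real.log (Real.exp 1 + 1 / d x y)) := by gcongr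
        _ = (|p x - p y| * Real.log (Real.exp 1 + 1 / d x y)) * (1 + Real.log D) := by ring
        _ ≤ C₀ * (1 + Real.log D) := by gcongr
        _ ≤ _ := le_add_of_nonneg_right (by positivity)
    · have h5 : Real.log (1 / r) ≤ Real.log (2 * D) := by
        refine Real.log_le_log (by positivity) ?_
        rw [div_le_iff₀ hr]
        linarith
      have h6 : 0 ≤ Real.log (1 / r) := Real.log_nonneg (by rw [le_div_iff₀ hr]; linarith)
      calc _ ≤ 2 * C₁ * Real.log (2 * D) := by
            gcongr
            exact hosc x y
        _ ≤ _ := le_add_of_nonneg_left (by positivity)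

/-- A power of the scale of a ball is controlled by the integral of a fixed integrable function. -/
theorem IsHomogeneousType.exists_scale_pow_le [MeasurableSpace X] {μ : Measure X}
    (hX : IsHomogeneousType d μ) (x₀ : X) {A κ : ℝ} (hA : 1 ≤ A) (hκ : 1 ≤ κ)
    (htri : ∀ x y z, d x y ≤ A * (d x z + d z y)) :
    ∃ (M : ℕ) (g : X → ℝ≥0∞), Measurable g ∧ ∫⁻ x, g x ∂μ < ∞ ∧
      ∀ (c : X) (r : ℝ), 0 < r → 2 * A * κ * r ≤ d c x₀ →
        ENNReal.ofReal (ballScale d x₀ c r ^ M) ≤ ∫⁻ x in d.ball c r, g x ∂μ := by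
  obtain ⟨L, hL⟩ := hX.exists_measure_ball_le_pow
  obtain ⟨K, g, hgm, hgi, hg⟩ := hX.exists_integrable_decay x₀
  have hμ1 := hX.measure_ball_pos x₀ one_pos
  have hμ1t := hX.measure_ball_lt_top x₀ one_pos
  set a : ℝ≥0∞ := ENNReal.ofReal ((2 * A) ^ L) * ENNReal.ofReal ((4 * A) ^ K) / μ (d.ball x₀ 1)
    with ha
  have hat : a ≠ ∞ := ENNReal.div_ne_top (by finiteness) hμ1.ne'
  refine ⟨L + K, fun x => a * g x, hgm.const_mul _, ?_, ?_⟩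
  · rw [lintegral_const_mul _ hgm]
    exact ENNReal.mul_lt_top hat.lt_top hgi
  intro c r hr hnc
  rw [lintegral_const_mul _ hgm]
  have hE := one_le_exp_add (d := d) c x₀
  have hρ := d.nonneg c x₀
  set E := Real.exp 1 + d c x₀ with hEdef
  have hEρ : 1 + d c x₀ ≤ E := by
    have := Real.add_one_le_exp (1 : ℝ)
    linarith
  have hmin : 0 < min r 1 := lt_min hr one_pos
  have hδ : ballScale d x₀ c r = min r 1 / E := rfl
  have hball : μ (d.ball x₀ 1) ≤
      ENNReal.ofReal ((2 * (A * E / min r 1)) ^ L) * μ (d.ball c r) := by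
    have h1 : d.ball x₀ 1 ⊆ d.ball c (A * E / min r 1 * min r 1) := by
      intro z hz
      have h2 : d x₀ z < 1 := hz
      have h3 := htri c z x₀
      rw [div_mul_cancel₀ _ hmin.ne']
      show d c z < A * E
      nlinarith
    refine (measure_mono h1).trans ((hL c _ _ hmin ?_).trans ?_)
    · rw [le_div_iff₀ hmin]
      have := min_le_right r 1
      nlinarith
    · gcongr
      exact d.ball_subset_ball c (min_le_left _ _)
  have hgB : ∀ x ∈ d.ball c r, ENNReal.ofReal ((1 / (2 * (2 * A * E))) ^ K) ≤ g x := by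
    intro x hx
    refine hg x _ (by nlinarith) ?_
    have h1 := htri x₀ x c
    have h2 : d c x < r := hx
    rw [d.symm x₀ c] at h1
    have h3 : r ≤ d c x₀ := by
      refine le_trans ?_ hnc
      nlinarith [mul_nonneg (sub_nonneg.2 hA) hr.le, mul_nonneg (sub_nonneg.2 hκ) hr.le,
        mul_nonneg (mul_nonneg (sub_nonneg.2 hA) (sub_nonneg.2 hκ)) hr.le]
    nlinarith
  have hint : ENNReal.ofReal ((1 / (2 * (2 * A * E))) ^ K) * μ (d.ball c r) ≤
      ∫⁻ x in d.ball c r, g x ∂μ := by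
    rw [← setLIntegral_const]
    exact setLIntegral_mono hgm hgB
  refine le_trans ?_ (mul_le_mul_right hint a)
  set b := μ (d.ball x₀ 1)
  have h5 : (1 : ℝ≥0∞) = b * b⁻¹ := (ENNReal.mul_inv_cancel hμ1.ne' hμ1t.ne).symm
  have h6 : (min r 1 / E) ^ (L + K) * (2 * (A * E / min r 1)) ^ L ≤
      (2 * A) ^ L * (4 * A) ^ K * (1 / (2 * (2 * A * E))) ^ K := by
    have e1 : (min r 1 / E) ^ (L + K) * (2 * (A * E / min r 1)) ^ L =
        (2 * A) ^ L * (min r 1 / E) ^ K := by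
      rw [pow_add, mul_right_comm, ← mul_pow]
      congr 2
      field_simp
    have e2 : (2 * A) ^ L * (4 * A) ^ K * (1 / (2 * (2 * A * E))) ^ K =
        (2 * A) ^ L * (1 / E) ^ K := by
      rw [mul_assoc, ← mul_pow]
      congr 2
      field_simp
      norm_num
    rw [e1, e2]
    gcongr
    exact min_le_right _ _
  calc ENNReal.ofReal (ballScale d x₀ c r ^ (L + K))
      = ENNReal.ofReal ((min r 1 / E) ^ (L + K)) * (b * b⁻¹) := by rw [← h5, mul_one, hδ]
    _ ≤ ENNReal.ofReal ((min r 1 / E) ^ (L + K)) *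
        (ENNReal.ofReal ((2 * (A * E / min r 1)) ^ L) * μ (d.ball c r) * b⁻¹) := by gcongr
    _ = ENNReal.ofReal ((min r 1 / E) ^ (L + K) * (2 * (A * E / min r 1)) ^ L) *
        μ (d.ball c r) * b⁻¹ := by rw [ENNReal.ofReal_mul (by positivity)]; ring
    _ ≤ ENNReal.ofReal ((2 * A) ^ L * (4 * A) ^ K * (1 / (2 * (2 * A * E))) ^ K) *
        μ (d.ball c r) * b⁻¹ := by gcongr
    _ = _ := by
      rw [ENNReal.ofReal_mul (by positivity), ENNReal.ofReal_mul (by positivity), ha,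
        ENNReal.div_eq_inv_mul]
      ring

end Geometry

section Exponents

variable {X : Type*} [MeasurableSpace X] {μ : Measure X} {p q : X → ℝ}

theorem exists_ae_lt_of_lt_essInf {a : ℝ} (ha : 0 ≤ a)
    (h : ENNReal.ofReal a < essInf (fun x => ENNReal.ofReal (p x)) μ) :
    ∃ b, a < b ∧ ∀ᵐ x ∂μ, b < p x := by
  obtain ⟨c, hc1, hc2⟩ := exists_between h
  refine ⟨c.toReal, (ENNReal.ofReal_lt_iff_lt_toReal ha hc2.ne_top).1 hc1, ?_⟩
  filter_upwards [ae_lt_of_lt_essInf hc2] with x hx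
  exact (ENNReal.lt_ofReal_iff_toReal_lt hc2.ne_top).1 hx

theorem exists_ae_lt_of_essSup_lt_top (hp : ∀ x, 0 ≤ p x)
    (h : essSup (fun x => ENNReal.ofReal (p x)) μ < ∞) : ∃ b, ∀ᵐ x ∂μ, p x < b := by
  obtain ⟨c, hc1, hc2⟩ := exists_between h
  refine ⟨c.toReal, ?_⟩
  filter_upwards [ae_lt_of_essSup_lt hc1] with x hx
  exact (ENNReal.ofReal_lt_iff_lt_toReal (hp x) hc2.ne).1 hx

theorem IsExpP.exists_lower (hp : IsExpP μ p) : ∃ a, 1 < a ∧ ∀ᵐ x ∂μ, a < p x :=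
  exists_ae_lt_of_lt_essInf zero_le_one (by simpa using hp.one_lt_essInf)

theorem IsExpP0.exists_lower (hq : IsExpP0 μ q) : ∃ a, 0 < a ∧ ∀ᵐ x ∂μ, a < q x :=
  exists_ae_lt_of_lt_essInf le_rfl (by simpa using hq.essInf_pos)

theorem IsExpP0.exists_upper (hq : IsExpP0 μ q) : ∃ b, ∀ᵐ x ∂μ, q x < b :=
  exists_ae_lt_of_essSup_lt_top hq.nonneg hq.essSup_lt_top

theorem IsExpP0.ae_pos (hq : IsExpP0 μ q) : ∀ᵐ x ∂μ, 0 < q x := by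
  obtain ⟨a, ha, h⟩ := hq.exists_lower
  exact h.mono fun x hx => ha.trans hx

theorem IsExpP.ae_conj (hp : IsExpP μ p) : ∀ᵐ x ∂μ, (p x).HolderConjugate (p x).conjExponent := by
  obtain ⟨a, ha, h⟩ := hp.exists_lower
  exact h.mono fun x hx => Real.HolderConjugate.conjExponent (ha.trans hx)

theorem IsExpP.ae_conj_pos (hp : IsExpP μ p) : ∀ᵐ x ∂μ, 0 < (p x).conjExponent :=
  hp.ae_conj.mono fun _ hx => hx.symm.pos

theorem IsExpP.measurable_conj (hp : IsExpP μ p) : Measurable fun x => (p x).conjExponent :=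
  hp.measurable.div (hp.measurable.sub_const 1)

theorem IsExpP.exists_conj_upper (hp : IsExpP μ p) :
    ∃ b, 1 ≤ b ∧ ∀ᵐ x ∂μ, (p x).conjExponent ≤ b := by
  obtain ⟨a, ha, h⟩ := hp.exists_lower
  refine ⟨a / (a - 1), ?_, ?_⟩
  · rw [le_div_iff₀ (by linarith)]
    linarith
  filter_upwards [h] with x hx
  rw [Real.conjExponent, div_le_div_iff₀ (by linarith) (by linarith)]
  nlinarith

end Exponents

section Weights

variable {X : Type*} [MeasurableSpace X] {d : QuasiMetric X} {μ : Measure X}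
  {m : ℕ} {η : ℝ} {pvec : Fin m → X → ℝ} {q : X → ℝ} {ω : Fin m → X → ℝ≥0∞}

theorem ae_prod_weight (hω : ∀ i, IsWeight d μ (ω i)) :
    ∀ᵐ x ∂μ, 0 < ∏ i, ω i x ∧ (∏ i, ω i x) * ∏ i, (ω i x)⁻¹ = 1 := by
  filter_upwards [ae_all_iff.2 fun i => (hω i).pos_finite] with x hx
  refine ⟨pos_iff_ne_zero.2 (Finset.prod_ne_zero_iff.2 fun i _ => (hx i).1.ne'), ?_⟩
  rw [← Finset.prod_mul_distrib]
  exact Finset.prod_eq_one fun i _ => ENNReal.mul_inv_cancel (hx i).1.ne' (hx i).2.ne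

theorem aemeasurable_prod_weight (hω : ∀ i, IsWeight d μ (ω i)) :
    AEMeasurable (fun x => ∏ i, ω i x) μ :=
  Finset.aemeasurable_fun_prod _ fun i _ => (hω i).aemeasurable

theorem luxNorm_weight_pos (hX : IsHomogeneousType d μ) (hq : IsExpP0 μ q)
    (hω : ∀ i, IsWeight d μ (ω i)) (c : X) {r : ℝ} (hr : 0 < r) :
    0 < luxNorm (μ.restrict (d.ball c r)) q (fun x => ∏ i, ω i x) :=
  luxNorm_pos (by simpa using (hX.measure_ball_pos c hr).ne') hq.measurable
    (ae_restrict_of_ae hq.ae_pos) (aemeasurable_prod_weight hω).restrict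
    (ae_restrict_of_ae ((ae_prod_weight hω).mono fun _ hx => hx.1))

theorem luxNorm_inv_weight_pos (hX : IsHomogeneousType d μ) (hpvec : ∀ i, IsExpP μ (pvec i))
    (hω : ∀ i, IsWeight d μ (ω i)) (i : Fin m) (c : X) {r : ℝ} (hr : 0 < r) :
    0 < luxNorm (μ.restrict (d.ball c r)) (fun x => (pvec i x).conjExponent)
      (fun x => (ω i x)⁻¹) :=
  luxNorm_pos (by simpa using (hX.measure_ball_pos c hr).ne') (hpvec i).measurable_conj
    (ae_restrict_of_ae (hpvec i).ae_conj_pos) (hω i).aemeasurable.inv.restrict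
    (ae_restrict_of_ae ((hω i).pos_finite.mono fun _ hx => ENNReal.inv_pos.2 hx.2.ne))

theorem mul_luxNorm_le_weightChar (ω₀ : X → ℝ≥0∞) (c : X) {r : ℝ} (hr : 0 < r) :
    μ (d.ball c r) ^ (η - (m : ℝ)) * luxNorm (μ.restrict (d.ball c r)) q ω₀ *
      ∏ i, luxNorm (μ.restrict (d.ball c r)) (fun x => Real.conjExponent (pvec i x))
        (fun x => (ω i x)⁻¹) ≤ weightChar d μ η pvec q ω ω₀ :=
  le_iSup_of_le c (le_iSup_of_le r (le_iSup_of_le hr le_rfl))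

theorem MemA.luxNorm_ne_top (hX : IsHomogeneousType d μ) (hq : IsExpP0 μ q)
    (hpvec : ∀ i, IsExpP μ (pvec i)) (hω : ∀ i, IsWeight d μ (ω i))
    (hA : MemA d μ η pvec q ω (fun x => ∏ i, ω i x)) (c : X) {r : ℝ} (hr : 0 < r) :
    luxNorm (μ.restrict (d.ball c r)) q (fun x => ∏ i, ω i x) ≠ ∞ ∧
    ∀ i, luxNorm (μ.restrict (d.ball c r)) (fun x => (pvec i x).conjExponent)
      (fun x => (ω i x)⁻¹) ≠ ∞ := by
  have h := (mul_luxNorm_le_weightChar (η := η) (pvec := pvec) (q := q) (ω := ω)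
    (fun x => ∏ i, ω i x) c hr).trans_lt hA
  have hμ : μ (d.ball c r) ^ (η - (m : ℝ)) ≠ 0 :=
    (ENNReal.rpow_pos (hX.measure_ball_pos c hr) (hX.measure_ball_lt_top c hr).ne).ne'
  have h0 := (luxNorm_weight_pos hX hq hω c hr).ne'
  have hi := fun i => (luxNorm_inv_weight_pos hX hpvec hω i c hr).ne'
  have hP := Finset.prod_ne_zero_iff.2 fun i (_ : i ∈ Finset.univ) => hi i
  refine ⟨fun ht => ?_, fun i ht => ?_⟩
  · rw [ht, ENNReal.mul_top hμ, ENNReal.top_mul hP] at h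
    exact lt_irrefl _ h
  · have : ∏ i, luxNorm (μ.restrict (d.ball c r)) (fun x => (pvec i x).conjExponent)
        (fun x => (ω i x)⁻¹) = ∞ := by
      rw [← Finset.mul_prod_erase _ _ (Finset.mem_univ i), ht]
      exact ENNReal.top_mul (Finset.prod_ne_zero_iff.2 fun j _ => hi j)
    rw [this, ENNReal.mul_top (mul_ne_zero hμ h0)] at h
    exact lt_irrefl _ h

/-- The reverse inequality to the weight condition, a consequence of Hölder's inequality. -/
theorem measure_ball_rpow_le (hX : IsHomogeneousType d μ) (hηm : η < m) (hq : IsExpP0 μ q)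
    (hpvec : ∀ i, IsExpP μ (pvec i)) (hsum : ∀ x, 1 / q x = ∑ i, 1 / pvec i x - η)
    (hω : ∀ i, IsWeight d μ (ω i)) (hA : MemA d μ η pvec q ω (fun x => ∏ i, ω i x))
    (c : X) {r : ℝ} (hr : 0 < r) :
    μ (d.ball c r) ^ ((m : ℝ) - η) ≤ (((m + 1 : ℕ) : ℝ≥0∞) ^ ((m : ℝ) - η) * 2 ^ (m + 1)) *
      (luxNorm (μ.restrict (d.ball c r)) q (fun x => ∏ i, ω i x) *
      ∏ i, luxNorm (μ.restrict (d.ball c r)) (fun x => (pvec i x).conjExponent)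
        (fun x => (ω i x)⁻¹)) := by
  set ν := μ.restrict (d.ball c r) with hν
  have hs : 0 < (m : ℝ) - η := sub_pos.2 hηm
  obtain ⟨ht, hti⟩ := hA.luxNorm_ne_top hX hq hpvec hω c hr
  have h0 := (luxNorm_weight_pos hX hq hω c hr).ne'
  have h0i := fun i => (luxNorm_inv_weight_pos hX hpvec hω i c hr).ne'
  let R : Option (Fin m) → X → ℝ := fun k => k.elim q fun i x => (pvec i x).conjExponent
  let H : Option (Fin m) → X → ℝ≥0∞ := fun k =>
    k.elim (fun x => ∏ i, ω i x) fun i x => (ω i x)⁻¹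
  let a : Option (Fin m) → ℝ≥0∞ := fun k => 2 * luxNorm ν (R k) (H k)
  have hn0 : ∀ k, luxNorm ν (R k) (H k) ≠ 0 := by rintro (_ | i); exacts [h0, h0i i]
  have hnt : ∀ k, luxNorm ν (R k) (H k) ≠ ∞ := by rintro (_ | i); exacts [ht, hti i]
  have hRpos : ∀ k, ∀ᵐ x ∂ν, 0 < R k x := by
    rintro (_ | i)
    exacts [ae_restrict_of_ae hq.ae_pos, ae_restrict_of_ae (hpvec i).ae_conj_pos]
  have key := lintegral_prod_rpow_le_card (μ := ν) (one_div_pos.2 hs) R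
    (by rintro (_ | i); exacts [hq.measurable, (hpvec i).measurable_conj]) hRpos
    (by
      refine ae_restrict_of_ae ?_
      filter_upwards [ae_all_iff.2 fun i => (hpvec i).ae_conj] with x hx
      rw [Fintype.sum_option, one_div_one_div]
      have : ∀ i, 1 / R (some i) x = 1 - 1 / pvec i x := fun i => by
        have := (hx i).inv_add_inv_eq_one
        simp only [R, Option.elim, one_div]
        linarith
      rw [Finset.sum_congr rfl fun i _ => this i]
      simp only [R, Option.elim, hsum, Finset.sum_sub_distrib]
      simp) H
    (by
      rintro (_ | i)
      exacts [(aemeasurable_prod_weight hω).restrict, (hω i).aemeasurable.inv.restrict]) a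
    (fun k => modular_le_one_of_luxNorm_lt ((hRpos k).mono fun x hx => hx.le) (by
      rw [show a k = 2 * luxNorm ν (R k) (H k) from rfl, two_mul]
      exact ENNReal.lt_add_right (hnt k) (hn0 k)))
  have ha0 : ∀ k, a k ≠ 0 := fun k => mul_ne_zero two_ne_zero (hn0 k)
  have hat : ∀ k, a k ≠ ∞ := fun k => ENNReal.mul_ne_top (by simp) (hnt k)
  have hP0 : ∏ k, a k ≠ 0 := Finset.prod_ne_zero_iff.2 fun k _ => ha0 k
  have hPt : ∏ k, a k ≠ ∞ := (ENNReal.prod_lt_top fun k _ => (hat k).lt_top).ne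
  have hint : ∫⁻ x, ∏ k, (H k x / a k) ^ (1 / ((m : ℝ) - η)) ∂ν =
      (∏ k, a k)⁻¹ ^ (1 / ((m : ℝ) - η)) * μ (d.ball c r) := by
    rw [lintegral_congr_ae (g := fun _ => (∏ k, a k)⁻¹ ^ (1 / ((m : ℝ) - η)))]
    · simp [hν]
    · refine ae_restrict_of_ae ?_
      filter_upwards [ae_prod_weight hω] with x hx
      rw [ENNReal.prod_rpow_of_nonneg (one_div_pos.2 hs).le]
      congr 1
      simp only [div_eq_mul_inv, Finset.prod_mul_distrib]
      rw [ENNReal.prod_inv_distrib fun i _ j _ _ => Or.inl (ha0 i),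
        Fintype.prod_option (fun k => H k x)]
      simp only [H, Option.elim, hx.2, one_mul]
  rw [hint] at key
  have h1 := ENNReal.rpow_le_rpow key hs.le
  rw [ENNReal.mul_rpow_of_nonneg _ _ hs.le, ← ENNReal.rpow_mul, one_div_mul_cancel hs.ne',
    ENNReal.rpow_one, mul_comm, ← div_eq_mul_inv, ENNReal.div_le_iff hP0 hPt] at h1
  refine h1.trans (le_of_eq ?_)
  have h2 : ∏ k, a k = 2 ^ (m + 1) * (luxNorm ν q (fun x => ∏ i, ω i x) *
      ∏ i, luxNorm ν (fun x => (pvec i x).conjExponent) (fun x => (ω i x)⁻¹)) := by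
    simp only [a, Finset.prod_mul_distrib, Finset.prod_const, Fintype.prod_option, R, H,
      Option.elim, Finset.card_univ, Fintype.card_option, Fintype.card_fin]
  rw [h2, Fintype.card_option, Fintype.card_fin, mul_assoc]

/-- The norm of the product weight over balls is doubling. -/
theorem MemA.exists_luxNorm_ball_le (hX : IsHomogeneousType d μ) (hηm : η < m)
    (hq : IsExpP0 μ q) (hpvec : ∀ i, IsExpP μ (pvec i))
    (hsum : ∀ x, 1 / q x = ∑ i, 1 / pvec i x - η)
    (hω : ∀ i, IsWeight d μ (ω i)) (hA : MemA d μ η pvec q ω (fun x => ∏ i, ω i x))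
    {κ : ℝ} (hκ : 1 ≤ κ) :
    ∃ D : ℝ≥0, ∀ (c : X) (r : ℝ), 0 < r →
      luxNorm (μ.restrict (d.ball c (κ * r))) q (fun x => ∏ i, ω i x) ≤
        D * luxNorm (μ.restrict (d.ball c r)) q (fun x => ∏ i, ω i x) := by
  obtain ⟨L, hL⟩ := hX.exists_measure_ball_le_pow
  have hs : 0 < (m : ℝ) - η := sub_pos.2 hηm
  set C₁ : ℝ≥0∞ := ((m + 1 : ℕ) : ℝ≥0∞) ^ ((m : ℝ) - η) * 2 ^ (m + 1) with hC₁
  set W := weightChar d μ η pvec q ω (fun x => ∏ i, ω i x) with hW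
  set D : ℝ≥0∞ := C₁ * W * ENNReal.ofReal ((2 * κ) ^ L) ^ ((m : ℝ) - η) with hD
  have hDt : D ≠ ∞ := by
    refine ENNReal.mul_ne_top (ENNReal.mul_ne_top (ENNReal.mul_ne_top ?_ (by finiteness)) hA.ne) ?_
    · exact ENNReal.rpow_ne_top_of_nonneg hs.le (by simp)
    · exact ENNReal.rpow_ne_top_of_nonneg hs.le (by simp)
  refine ⟨D.toNNReal, fun c r hr => ?_⟩
  rw [ENNReal.coe_toNNReal hDt]
  have hκr : 0 < κ * r := by positivity
  set N := luxNorm (μ.restrict (d.ball c r)) q (fun x => ∏ i, ω i x)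
  set N' := luxNorm (μ.restrict (d.ball c (κ * r))) q (fun x => ∏ i, ω i x)
  have h1 := measure_ball_rpow_le hX hηm hq hpvec hsum hω hA c hr
  have h2 := mul_luxNorm_le_weightChar (d := d) (μ := μ) (η := η) (pvec := pvec) (q := q) (ω := ω)
    (fun x => ∏ i, ω i x) c hκr
  have hμ0 := (hX.measure_ball_pos c hr).ne'
  have hμt := (hX.measure_ball_lt_top c hr).ne
  have hμ0' := (hX.measure_ball_pos c hκr).ne'
  have hμt' := (hX.measure_ball_lt_top c hκr).ne
  have hprod : ∏ i, luxNorm (μ.restrict (d.ball c r)) (fun x => (pvec i x).conjExponent)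
        (fun x => (ω i x)⁻¹) ≤ ∏ i, luxNorm (μ.restrict (d.ball c (κ * r)))
          (fun x => (pvec i x).conjExponent) (fun x => (ω i x)⁻¹) :=
    Finset.prod_le_prod' fun i _ => luxNorm_mono_measure
      (Measure.restrict_mono (d.ball_subset_ball c (by nlinarith)) le_rfl)
  set P := ∏ i, luxNorm (μ.restrict (d.ball c r)) (fun x => (pvec i x).conjExponent)
        (fun x => (ω i x)⁻¹)
  set P' := ∏ i, luxNorm (μ.restrict (d.ball c (κ * r)))
          (fun x => (pvec i x).conjExponent) (fun x => (ω i x)⁻¹)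
  have h3 : N' * P' ≤ W * μ (d.ball c (κ * r)) ^ ((m : ℝ) - η) := by
    have e : μ (d.ball c (κ * r)) ^ (η - (m : ℝ)) = (μ (d.ball c (κ * r)) ^ ((m : ℝ) - η))⁻¹ := by
      rw [← ENNReal.rpow_neg, neg_sub]
    rw [e, mul_assoc, ← ENNReal.div_eq_inv_mul, ENNReal.div_le_iff] at h2
    · exact h2
    · exact (ENNReal.rpow_pos hμ0'.bot_lt hμt').ne'
    · exact ENNReal.rpow_ne_top_of_nonneg hs.le hμt'
  have h4 : μ (d.ball c (κ * r)) ^ ((m : ℝ) - η) ≤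
      ENNReal.ofReal ((2 * κ) ^ L) ^ ((m : ℝ) - η) * μ (d.ball c r) ^ ((m : ℝ) - η) := by
    rw [← ENNReal.mul_rpow_of_nonneg _ _ hs.le]
    exact ENNReal.rpow_le_rpow (hL c r κ hr hκ) hs.le
  have hV0 : μ (d.ball c r) ^ ((m : ℝ) - η) ≠ 0 := (ENNReal.rpow_pos hμ0.bot_lt hμt).ne'
  have hVt : μ (d.ball c r) ^ ((m : ℝ) - η) ≠ ∞ := ENNReal.rpow_ne_top_of_nonneg hs.le hμt
  rw [← ENNReal.mul_le_mul_iff_left hV0 hVt]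
  calc N' * μ (d.ball c r) ^ ((m : ℝ) - η) ≤ N' * (C₁ * (N * P')) := by
        gcongr
        exact h1.trans (by gcongr)
    _ = C₁ * N * (N' * P') := by ring
    _ ≤ C₁ * N * (W * (ENNReal.ofReal ((2 * κ) ^ L) ^ ((m : ℝ) - η) *
        μ (d.ball c r) ^ ((m : ℝ) - η))) :=
        mul_le_mul_right (h3.trans (mul_le_mul_right h4 W)) _
    _ = _ := by rw [hD]; ring

/-- Local integrals are controlled by weighted norms. -/
theorem MemA.setLIntegral_le (hX : IsHomogeneousType d μ) (hq : IsExpP0 μ q)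
    (hpvec : ∀ i, IsExpP μ (pvec i)) (hω : ∀ i, IsWeight d μ (ω i))
    (hA : MemA d μ η pvec q ω (fun x => ∏ i, ω i x)) (i : Fin m) {f : X → ℝ}
    (hf : AEMeasurable f μ) (c : X) {r : ℝ} (hr : 0 < r) :
    ∫⁻ x in d.ball c r, ‖f x‖ₑ ∂μ ≤
      2 * (luxNorm (μ.restrict (d.ball c r)) (pvec i) (fun x => ω i x * ‖f x‖ₑ) *
        luxNorm (μ.restrict (d.ball c r)) (fun x => (pvec i x).conjExponent)
          (fun x => (ω i x)⁻¹)) := by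
  have h := lintegral_mul_le_luxNorm_mul_luxNorm (μ := μ.restrict (d.ball c r))
    (hpvec i).measurable (hpvec i).measurable_conj
    (ae_of_all _ fun x => one_pos.trans_le ((hpvec i).one_le x))
    (ae_restrict_of_ae (hpvec i).ae_conj_pos)
    (ae_restrict_of_ae ((hpvec i).ae_conj.mono fun x hx => by
      simpa [one_div] using hx.inv_add_inv_eq_one))
    ((hω i).aemeasurable.mul hf.enorm).restrict (hω i).aemeasurable.inv.restrict
    (luxNorm_inv_weight_pos hX hpvec hω i c hr).ne'
    ((hA.luxNorm_ne_top hX hq hpvec hω c hr).2 i)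
  refine le_trans (le_of_eq (lintegral_congr_ae (ae_restrict_of_ae ?_))) h
  filter_upwards [(hω i).pos_finite] with x hx
  simp only [Pi.mul_apply, Pi.inv_apply]
  rw [mul_right_comm, ENNReal.mul_inv_cancel hx.1.ne' hx.2.ne, one_mul]

theorem fracAverage_eq (η : ℝ) (f : Fin m → X → ℝ) {B : Set X} (h0 : μ B ≠ 0) (ht : μ B ≠ ∞) :
    fracAverage μ η f B = μ B ^ (η - (m : ℝ)) * ∏ i, ∫⁻ y in B, ‖f i y‖ₑ ∂μ := by
  rw [fracAverage, Finset.prod_mul_distrib, ← mul_assoc]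
  congr 1
  rw [ENNReal.rpow_sub _ _ h0 ht, div_eq_mul_inv]
  simp [← ENNReal.inv_pow]

/-- The average over a ball, times the norm of the weight, is controlled by local norms. -/
theorem MemA.fracAverage_mul_luxNorm_le (hX : IsHomogeneousType d μ) (hq : IsExpP0 μ q)
    (hpvec : ∀ i, IsExpP μ (pvec i)) (hω : ∀ i, IsWeight d μ (ω i))
    (hA : MemA d μ η pvec q ω (fun x => ∏ i, ω i x)) {f : Fin m → X → ℝ}
    (hf : ∀ i, AEMeasurable (f i) μ) (c : X) {r : ℝ} (hr : 0 < r) :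
    fracAverage μ η f (d.ball c r) *
        luxNorm (μ.restrict (d.ball c r)) q (fun x => ∏ i, ω i x) ≤
      2 ^ m * weightChar d μ η pvec q ω (fun x => ∏ i, ω i x) *
        ∏ i, luxNorm (μ.restrict (d.ball c r)) (pvec i) (fun x => ω i x * ‖f i x‖ₑ) := by
  have h2 := mul_luxNorm_le_weightChar (d := d) (μ := μ) (η := η) (pvec := pvec) (q := q) (ω := ω)
    (fun x => ∏ i, ω i x) c hr
  rw [fracAverage_eq η f (hX.measure_ball_pos c hr).ne' (hX.measure_ball_lt_top c hr).ne]
  calc _ ≤ μ (d.ball c r) ^ (η - (m : ℝ)) *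
        (∏ i, 2 * (luxNorm (μ.restrict (d.ball c r)) (pvec i) (fun x => ω i x * ‖f i x‖ₑ) *
        luxNorm (μ.restrict (d.ball c r)) (fun x => (pvec i x).conjExponent)
          (fun x => (ω i x)⁻¹))) *
        luxNorm (μ.restrict (d.ball c r)) q (fun x => ∏ i, ω i x) := by
        gcongr with i
        exact hA.setLIntegral_le hX hq hpvec hω i (hf i) c hr
    _ = 2 ^ m * (μ (d.ball c r) ^ (η - (m : ℝ)) *
        luxNorm (μ.restrict (d.ball c r)) q (fun x => ∏ i, ω i x) *
      ∏ i, luxNorm (μ.restrict (d.ball c r)) (fun x => Real.conjExponent (pvec i x))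
        (fun x => (ω i x)⁻¹)) *
        ∏ i, luxNorm (μ.restrict (d.ball c r)) (pvec i) (fun x => ω i x * ‖f i x‖ₑ) := by
        simp only [Finset.prod_mul_distrib, Finset.prod_const, Finset.card_univ, Fintype.card_fin]
        ring
    _ ≤ _ := by gcongr

end Weights

/-- Changing the exponent of a number that is not too small costs a constant factor. -/
theorem rpow_le_exp_mul_rpow {v : ℝ≥0∞} {δ N K a b : ℝ} (hδ : 0 < δ) (hN : 0 ≤ N)
    (hv : ENNReal.ofReal (δ ^ N) ≤ v) (hv1 : v ≤ 1) (hab : |a - b| * Real.log (1 / δ) ≤ K) :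
    v ^ a ≤ ENNReal.ofReal (Real.exp (N * K)) * v ^ b := by
  have hvt : v ≠ ∞ := ne_top_of_le_ne_top ENNReal.one_ne_top hv1
  lift v to ℝ≥0 using hvt
  have hδN : 0 < δ ^ N := Real.rpow_pos_of_pos hδ N
  have hv' : δ ^ N ≤ v := by
    rw [← ENNReal.ofReal_coe_nnreal] at hv
    exact (ENNReal.ofReal_le_ofReal_iff v.2).1 hv
  have hv0 : (0 : ℝ) < v := hδN.trans_le hv'
  have hv1' : (v : ℝ) ≤ 1 := by exact_mod_cast hv1
  rw [← ENNReal.ofReal_coe_nnreal, ENNReal.ofReal_rpow_of_pos hv0, ENNReal.ofReal_rpow_of_pos hv0,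
    ← ENNReal.ofReal_mul (Real.exp_pos _).le]
  refine ENNReal.ofReal_le_ofReal ?_
  have h1 : (v : ℝ) ^ a = v ^ (a - b) * v ^ b := by
    rw [← Real.rpow_add hv0, sub_add_cancel]
  rw [h1]
  gcongr
  rw [Real.rpow_def_of_pos hv0]
  refine Real.exp_le_exp.2 ?_
  have hlog : -Real.log v ≤ N * Real.log (1 / δ) := by
    have h2 := Real.log_le_log hδN hv'
    rw [Real.log_rpow hδ] at h2
    rw [one_div, Real.log_inv]
    linarith
  have hlog0 : 0 ≤ -Real.log v := neg_nonneg.2 (Real.log_nonpos hv0.le hv1')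
  calc Real.log v * (a - b) ≤ |Real.log v * (a - b)| := le_abs_self _
    _ = -Real.log v * |a - b| := by rw [abs_mul, abs_of_nonpos (by linarith)]
    _ ≤ N * Real.log (1 / δ) * |a - b| := by gcongr
    _ = N * (|a - b| * Real.log (1 / δ)) := by ring
    _ ≤ N * K := by gcongr

theorem abs_sub_le_of_one_div {X : Type*} {m : ℕ} {η : ℝ} {pvec : Fin m → X → ℝ} {q : X → ℝ}
    {a b : ℝ} (hsum : ∀ x, 1 / q x = ∑ i, 1 / pvec i x - η)
    (hone : ∀ i x, 1 ≤ pvec i x) (ha : 0 < a) {x y : X} (hx : a < q x ∧ q x < b)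
    (hy : a < q y ∧ q y < b) : |q x - q y| ≤ b ^ 2 * ∑ i, |pvec i x - pvec i y| := by
  have hqx : 0 < q x := ha.trans hx.1
  have hqy : 0 < q y := ha.trans hy.1
  have h1 : |1 / q x - 1 / q y| ≤ ∑ i, |pvec i x - pvec i y| := by
    rw [hsum, hsum, sub_sub_sub_cancel_right, ← Finset.sum_sub_distrib]
    refine (Finset.abs_sum_le_sum_abs _ _).trans (Finset.sum_le_sum fun i _ => ?_)
    have hpx := hone i x
    have hpy := hone i y
    rw [div_sub_div _ _ (by positivity) (by positivity), one_mul, mul_one, abs_div, abs_sub_comm]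
    refine div_le_self (abs_nonneg _) ?_
    rw [abs_of_pos (by positivity)]
    nlinarith
  have h2 : q x - q y = q x * q y * (1 / q y - 1 / q x) := by field_simp
  rw [h2, abs_mul, abs_of_pos (by positivity), abs_sub_comm, sq]
  have hb : 0 < b := hqx.trans hx.2
  gcongr
  · exact hx.2.le
  · exact hy.2.le

section Core

variable {X : Type*} [MeasurableSpace X] {d : QuasiMetric X} {μ : Measure X}
  {m : ℕ} {η : ℝ} {pvec : Fin m → X → ℝ} {q : X → ℝ}

theorem exists_mem_ball_of_ae (hX : IsHomogeneousType d μ) {P : X → Prop} (hP : ∀ᵐ x ∂μ, P x)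
    (c : X) {r : ℝ} (hr : 0 < r) : ∃ y ∈ d.ball c r, P y := by
  by_contra! h
  exact (hX.measure_ball_pos c hr).ne' (measure_mono_null h (ae_iff.1 hP))

/-- The estimate for a single ball far from the base point. -/
theorem exists_setLIntegral_ball_le (hX : IsHomogeneousType d μ) (x₀ : X) (hη : 0 ≤ η)
    (hq : IsExpP0 μ q) (hpvec : ∀ i, IsExpP μ (pvec i)) (hLH : ∀ i, LH d x₀ (pvec i))
    (hsum : ∀ x, 1 / q x = ∑ i, 1 / pvec i x - η) {A κ : ℝ} (hA : 1 ≤ A) (hκ : 1 ≤ κ)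
    (htri : ∀ x y z, d x y ≤ A * (d x z + d z y)) :
    ∃ (C : ℝ≥0) (g : X → ℝ≥0∞), ∫⁻ x, g x ∂μ < ∞ ∧
      ∀ (c : X) (r : ℝ), 0 < r → 2 * A * κ * r ≤ d c x₀ →
      ∀ (h : X → ℝ≥0∞) (F : Fin m → X → ℝ≥0∞),
        (∀ i, luxNorm (μ.restrict (d.ball c r)) (pvec i) (F i) ≤ 1) →
        luxNorm (μ.restrict (d.ball c (κ * r))) q h <
          ∏ i, luxNorm (μ.restrict (d.ball c r)) (pvec i) (F i) / 2 →
        ∫⁻ x in d.ball c (κ * r), h x ^ q x ∂μ ≤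
          C * (∫⁻ x in d.ball c r, g x ∂μ + ∑ i, ∫⁻ x in d.ball c r, F i x ^ pvec i x ∂μ) := by
  obtain ⟨a, ha, haq⟩ := hq.exists_lower
  obtain ⟨b, hbq⟩ := hq.exists_upper
  have hG : ∀ᵐ x ∂μ, a < q x ∧ q x < b := haq.and hbq
  choose K hK0 hK using fun i => (hLH i).exists_osc_le hA hκ htri
  obtain ⟨M, g, hgm, hgi, hg⟩ := hX.exists_scale_pow_le x₀ hA hκ htri
  set N : ℝ := M / a with hN
  have hN0 : 0 ≤ N := by positivity
  set e₁ : ℝ≥0∞ := ENNReal.ofReal (Real.exp (N * (b ^ 2 * ∑ i, K i))) with he₁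
  set e₂ : ℝ≥0∞ := ENNReal.ofReal (Real.exp (N * ∑ i, K i)) with he₂
  have het : 1 + e₁ * e₂ ≠ ∞ := by finiteness
  refine ⟨(1 + e₁ * e₂).toNNReal, g, hgi, ?_⟩
  intro c r hr hnc h F hF1 hlt
  rw [ENNReal.coe_toNNReal het]
  set δ := ballScale d x₀ c r with hδ
  have hδ0 : 0 < δ := ballScale_pos x₀ c hr
  have hδ1 : δ ≤ 1 := ballScale_le_one x₀ c r
  have hlogδ : 0 ≤ Real.log (1 / δ) := Real.log_nonneg (by rw [le_div_iff₀ hδ0]; linarith)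
  have hκr : 0 < κ * r := by positivity
  have hBsub : d.ball c r ⊆ d.ball c (κ * r) := d.ball_subset_ball c (by nlinarith)
  set v : Fin m → ℝ≥0∞ := fun i => luxNorm (μ.restrict (d.ball c r)) (pvec i) (F i) / 2 with hv
  set P := ∏ i, v i with hP
  have hP0 : P ≠ 0 := (bot_le.trans_lt hlt).ne'
  have hv0 : ∀ i, v i ≠ 0 := fun i => Finset.prod_ne_zero_iff.1 hP0 i (Finset.mem_univ i)
  have hv1 : ∀ i, v i ≤ 1 := fun i => ENNReal.half_le_self.trans (hF1 i)
  have hP1 : P ≤ 1 := Finset.prod_le_one' fun i _ => hv1 i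
  have hPv : ∀ i, P ≤ v i := fun i => by
    rw [hP, ← Finset.mul_prod_erase _ _ (Finset.mem_univ i)]
    exact mul_le_of_le_one_right' (Finset.prod_le_one' fun j _ => hv1 j)
  have hPt : P ≠ ∞ := ne_top_of_le_ne_top ENNReal.one_ne_top hP1
  have hvt : ∀ i, v i ≠ ∞ := fun i => ne_top_of_le_ne_top ENNReal.one_ne_top (hv1 i)
  have hmod : ∫⁻ x in d.ball c (κ * r), (h x / P) ^ q x ∂μ ≤ 1 :=
    modular_le_one_of_luxNorm_lt (ae_of_all _ hq.nonneg) hlt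
  have hFmod : ∀ i, 1 ≤ ∫⁻ x in d.ball c r, (F i x / v i) ^ pvec i x ∂μ := fun i => by
    refine (one_lt_modular_of_lt_luxNorm (hv0 i) (ENNReal.half_lt_self ?_ ?_)).le
    · intro h0
      exact hv0 i (by simp [hv, h0])
    · exact ne_top_of_le_ne_top ENNReal.one_ne_top (hF1 i)
  -- factoring the modular through its normalization
  have hfactor : ∀ E : ℝ≥0∞, E ≠ ∞ →
      (∀ x ∈ d.ball c (κ * r), a < q x ∧ q x < b → P ^ q x ≤ E) →
      ∫⁻ x in d.ball c (κ * r), h x ^ q x ∂μ ≤ E := by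
    intro E hEt hE
    calc _ ≤ ∫⁻ x in d.ball c (κ * r), (h x / P) ^ q x * E ∂μ := by
          refine lintegral_mono_ae ?_
          filter_upwards [ae_restrict_of_ae hG, ae_restrict_mem (hX.measurableSet_ball c hκr)]
            with x hx hxB
          calc h x ^ q x = (h x / P * P) ^ q x := by rw [ENNReal.div_mul_cancel hP0 hPt]
            _ = (h x / P) ^ q x * P ^ q x := ENNReal.mul_rpow_of_nonneg _ _ (hq.nonneg x)
            _ ≤ _ := by gcongr; exact hE x hxB hx
      _ ≤ (∫⁻ x in d.ball c (κ * r), (h x / P) ^ q x ∂μ) * E := by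
          rw [lintegral_mul_const' _ _ hEt]
      _ ≤ 1 * E := by gcongr
      _ = E := one_mul E
  rcases le_or_gt (ENNReal.ofReal (δ ^ N)) P with hcase | hcase
  · obtain ⟨y, hyB, hy⟩ := exists_mem_ball_of_ae hX hG c hr
    have hosc : ∀ i, ∀ x ∈ d.ball c (κ * r), ∀ y ∈ d.ball c (κ * r),
        |pvec i x - pvec i y| * Real.log (1 / δ) ≤ ∑ i, K i := fun i x hx y hy =>
      (hK i c r hr hnc x hx y hy).trans
        (Finset.single_le_sum (fun j _ => hK0 j) (Finset.mem_univ i))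
    have h1 : ∫⁻ x in d.ball c (κ * r), h x ^ q x ∂μ ≤ e₁ * P ^ q y := by
      refine hfactor _ (ENNReal.mul_ne_top (by simp [he₁])
        (ENNReal.rpow_ne_top_of_nonneg (hq.nonneg y) hPt)) fun x hxB hx => ?_
      refine rpow_le_exp_mul_rpow hδ0 hN0 hcase hP1 ?_
      calc |q x - q y| * Real.log (1 / δ)
          ≤ b ^ 2 * (∑ i, |pvec i x - pvec i y|) * Real.log (1 / δ) := by
            gcongr
            exact abs_sub_le_of_one_div hsum (fun i x => (hpvec i).one_le x) ha hx hy
        _ = b ^ 2 * ∑ i, |pvec i x - pvec i y| * Real.log (1 / δ) := by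
            rw [mul_assoc, Finset.sum_mul]
        _ ≤ _ := by
            gcongr with i
            exact hK i c r hr hnc x hxB y (hBsub hyB)
    have h2 : P ^ q y ≤ ∑ i, v i ^ pvec i y := by
      refine prod_rpow_le_sum_rpow_of_le_one (ha.trans hy.1) (fun i => pvec i y)
        (fun i => one_pos.trans_le ((hpvec i).one_le y)) ?_ v hv1
      rw [hsum]
      linarith
    have h3 : ∀ i, v i ^ pvec i y ≤ e₂ * ∫⁻ x in d.ball c r, F i x ^ pvec i x ∂μ := by
      intro i
      have hp0 : ∀ x, 0 ≤ pvec i x := fun x => zero_le_one.trans ((hpvec i).one_le x)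
      calc v i ^ pvec i y
          ≤ v i ^ pvec i y * ∫⁻ x in d.ball c r, (F i x / v i) ^ pvec i x ∂μ :=
            le_mul_of_one_le_right' (hFmod i)
        _ = ∫⁻ x in d.ball c r, v i ^ pvec i y * (F i x / v i) ^ pvec i x ∂μ :=
            (lintegral_const_mul' _ _ (ENNReal.rpow_ne_top_of_nonneg (hp0 y) (hvt i))).symm
        _ ≤ ∫⁻ x in d.ball c r, e₂ * F i x ^ pvec i x ∂μ := by
            refine lintegral_mono_ae ?_
            filter_upwards [ae_restrict_mem (hX.measurableSet_ball c hr)] with x hx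
            calc v i ^ pvec i y * (F i x / v i) ^ pvec i x
                ≤ e₂ * v i ^ pvec i x * (F i x / v i) ^ pvec i x := by
                  gcongr
                  exact rpow_le_exp_mul_rpow hδ0 hN0 (hcase.trans (hPv i)) (hv1 i)
                    (hosc i y (hBsub hyB) x (hBsub hx))
              _ = e₂ * (F i x / v i * v i) ^ pvec i x := by
                  rw [ENNReal.mul_rpow_of_nonneg _ _ (hp0 x)]
                  ring
              _ = e₂ * F i x ^ pvec i x := by rw [ENNReal.div_mul_cancel (hv0 i) (hvt i)]
        _ = _ := lintegral_const_mul' _ _ (by simp [he₂])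
    calc _ ≤ e₁ * ∑ i, e₂ * ∫⁻ x in d.ball c r, F i x ^ pvec i x ∂μ := by
          refine h1.trans ?_
          gcongr
          exact h2.trans (Finset.sum_le_sum fun i _ => h3 i)
      _ = e₁ * e₂ * ∑ i, ∫⁻ x in d.ball c r, F i x ^ pvec i x ∂μ := by
          rw [← Finset.mul_sum, mul_assoc]
      _ ≤ _ := mul_le_mul' le_add_self le_add_self
  · have h1 : ∫⁻ x in d.ball c (κ * r), h x ^ q x ∂μ ≤ ENNReal.ofReal (δ ^ M) := by
      refine hfactor _ ENNReal.ofReal_ne_top fun x hxB hx => ?_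
      calc P ^ q x ≤ P ^ a := ENNReal.rpow_le_rpow_of_exponent_ge hP1 hx.1.le
        _ ≤ ENNReal.ofReal (δ ^ N) ^ a := ENNReal.rpow_le_rpow hcase.le ha.le
        _ = ENNReal.ofReal (δ ^ M) := by
          rw [ENNReal.ofReal_rpow_of_pos (Real.rpow_pos_of_pos hδ0 N), ← Real.rpow_mul hδ0.le, hN,
            div_mul_cancel₀ _ ha.ne', Real.rpow_natCast]
    calc _ ≤ 1 * ∫⁻ x in d.ball c r, g x ∂μ := by rw [one_mul]; exact h1.trans (hg c r hr hnc)
      _ ≤ _ := mul_le_mul' le_self_add le_self_add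

/-- The modular of a function over a union of balls, each of which satisfies the local estimate,
is bounded by a constant that does not depend on the family of balls. -/
theorem exists_setLIntegral_iUnion_ball_le (hX : IsHomogeneousType d μ) (x₀ : X) (hη : 0 ≤ η)
    (hq : IsExpP0 μ q) (hpvec : ∀ i, IsExpP μ (pvec i)) (hLH : ∀ i, LH d x₀ (pvec i))
    (hsum : ∀ x, 1 / q x = ∑ i, 1 / pvec i x - η) :
    ∃ (C : ℝ≥0) (κ : ℝ), 1 ≤ κ ∧ ∀ (h : X → ℝ≥0∞) (F : Fin m → X → ℝ≥0∞),
      (∀ i, ∫⁻ x, F i x ^ pvec i x ∂μ ≤ 1) → ∀ (S : Set (X × ℝ)) (R : ℝ),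
      (∀ b ∈ S, 0 < b.2 ∧ b.2 ≤ R) →
      (∀ b ∈ S, luxNorm (μ.restrict (d.ball b.1 (κ * b.2))) q h <
          ∏ i, luxNorm (μ.restrict (d.ball b.1 b.2)) (pvec i) (F i) / 2) →
      ∫⁻ x in ⋃ b ∈ S, d.ball b.1 b.2, h x ^ q x ∂μ ≤ C := by
  obtain ⟨A, hA, htri⟩ := d.quasi_triangle
  have hκ₁ : 1 ≤ 5 * A ^ 2 := by nlinarith
  obtain ⟨C, g, hgi, hC⟩ := exists_setLIntegral_ball_le hX x₀ hη hq hpvec hLH hsum hA hκ₁ htri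
  set κ₁ := 5 * A ^ 2 with hκ₁def
  set Λ := 2 * A * κ₁ with hΛ
  have hΛ0 : 0 < Λ := by positivity
  set κ₂ := A * (Λ + A * (Λ + 1) * 2) with hκ₂def
  have hκ₂ : 0 < κ₂ := by positivity
  have := hX.sigmaFinite x₀
  have hCt : 1 + (C : ℝ≥0∞) * (∫⁻ x, g x ∂μ + m) ≠ ∞ := by finiteness
  refine ⟨(1 + (C : ℝ≥0∞) * (∫⁻ x, g x ∂μ + m)).toNNReal, κ₁ + κ₂, by linarith, ?_⟩
  intro h F hF S R hS hlt
  rw [ENNReal.coe_toNNReal hCt]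
  have hFn : ∀ (B : Set X) i, luxNorm (μ.restrict B) (pvec i) (F i) ≤ 1 := fun B i =>
    (luxNorm_mono_measure Measure.restrict_le_self).trans
      (luxNorm_le_of_modular_le_one one_ne_zero ENNReal.one_ne_top (by simpa using hF i))
  let Sc : Set (X × ℝ) := {b ∈ S | d b.1 x₀ < Λ * b.2}
  let Sn : Set (X × ℝ) := {b ∈ S | Λ * b.2 ≤ d b.1 x₀}
  have hcov : (⋃ b ∈ S, d.ball b.1 b.2) ⊆
      (⋃ b ∈ Sc, d.ball b.1 b.2) ∪ ⋃ b ∈ Sn, d.ball b.1 b.2 := by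
    refine Set.iUnion₂_subset fun b hb => ?_
    rcases lt_or_ge (d b.1 x₀) (Λ * b.2) with h1 | h1
    · exact Set.subset_union_of_subset_left
        (Set.subset_biUnion_of_mem (u := fun b : X × ℝ => d.ball b.1 b.2)
          (show b ∈ Sc from ⟨hb, h1⟩)) _
    · exact Set.subset_union_of_subset_right
        (Set.subset_biUnion_of_mem (u := fun b : X × ℝ => d.ball b.1 b.2)
          (show b ∈ Sn from ⟨hb, h1⟩)) _
  have hcentral : ∫⁻ x in ⋃ b ∈ Sc, d.ball b.1 b.2, h x ^ q x ∂μ ≤ 1 := by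
    rcases Sc.eq_empty_or_nonempty with hempty | hne
    · simp [hempty]
    have hbdd : BddAbove (Prod.snd '' Sc) := ⟨R, by
      rintro _ ⟨b, hb, rfl⟩
      exact (hS b hb.1).2⟩
    have hsup : 0 < sSup (Prod.snd '' Sc) := by
      obtain ⟨b, hb⟩ := hne
      exact (hS b hb.1).1.trans_le (le_csSup hbdd ⟨b, hb, rfl⟩)
    obtain ⟨_, ⟨b, hb, rfl⟩, hb2⟩ := exists_lt_of_lt_csSup (hne.image _) (half_lt_self hsup)
    have hr := (hS b hb.1).1
    have hsub : (⋃ b ∈ Sc, d.ball b.1 b.2) ⊆ d.ball b.1 ((κ₁ + κ₂) * b.2) := by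
      refine Set.iUnion₂_subset fun b' hb' x hx => ?_
      have h1 : b'.2 ≤ 2 * b.2 := by
        have := le_csSup hbdd ⟨b', hb', rfl⟩
        linarith
      have h2 : d b.1 x₀ < Λ * b.2 := hb.2
      have h3 : d b'.1 x₀ < Λ * b'.2 := hb'.2
      have h4 : d b'.1 x < b'.2 := hx
      have h5 := htri b.1 x x₀
      have h6 := htri x₀ x b'.1
      rw [d.symm x₀ b'.1] at h6
      have h7 : d x₀ x ≤ A * ((Λ + 1) * (2 * b.2)) := by
        refine h6.trans ?_
        gcongr
        nlinarith
      have h8 : d b.1 x ≤ κ₂ * b.2 := by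
        refine h5.trans ?_
        rw [hκ₂def, mul_assoc]
        gcongr
        nlinarith
      show d b.1 x < (κ₁ + κ₂) * b.2
      nlinarith
    have hlt1 : luxNorm (μ.restrict (d.ball b.1 ((κ₁ + κ₂) * b.2))) q h < 1 :=
      (hlt b hb.1).trans_le
        (Finset.prod_le_one' fun i _ => ENNReal.half_le_self.trans (hFn _ i))
    have := modular_le_one_of_luxNorm_lt (ae_of_all _ hq.nonneg) hlt1
    simp only [div_one] at this
    exact (lintegral_mono_set hsub).trans this
  have hnoncentral : ∫⁻ x in ⋃ b ∈ Sn, d.ball b.1 b.2, h x ^ q x ∂μ ≤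
      C * (∫⁻ x, g x ∂μ + m) := by
    obtain ⟨u, huS, hdisj, hu⟩ := Vitali.exists_disjoint_subfamily_covering_enlargement
      (fun b : X × ℝ => d.ball b.1 b.2) Sn Prod.snd 2 one_lt_two
      (fun b hb => (hS b hb.1).1.le) R (fun b hb => (hS b hb.1).2)
      (fun b hb => ⟨b.1, d.mem_ball_self _ (hS b hb.1).1⟩)
    have hmeas : ∀ b ∈ u, MeasurableSet (d.ball b.1 b.2) := fun b hb =>
      hX.measurableSet_ball _ (hS b (huS hb).1).1
    have hcount : u.Countable := by
      have h1 := Measure.countable_meas_pos_of_disjoint_iUnion (μ := μ)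
        (As := fun b : u => d.ball b.1.1 b.1.2) (fun b => hmeas b b.2)
        (fun x y hxy => hdisj x.2 y.2 (Subtype.coe_injective.ne hxy))
      rw [Set.eq_univ_of_forall (s := {b : u | 0 < μ (d.ball b.1.1 b.1.2)})
        (fun b => hX.measure_ball_pos _ (hS b (huS b.2).1).1)] at h1
      exact Set.countable_coe_iff.1 (Set.countable_univ_iff.1 h1)
    have hsub : (⋃ b ∈ Sn, d.ball b.1 b.2) ⊆ ⋃ b ∈ u, d.ball b.1 (κ₁ * b.2) := by
      refine Set.iUnion₂_subset fun a ha x hx => ?_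
      obtain ⟨b, hb, ⟨z, hza, hzb⟩, hab⟩ := hu a ha
      refine Set.mem_iUnion₂.2 ⟨b, hb, ?_⟩
      have h1 : d a.1 x < a.2 := hx
      have h2 : d a.1 z < a.2 := hza
      have h3 : d b.1 z < b.2 := hzb
      have h4 := htri b.1 x z
      have h5 := htri z x a.1
      rw [d.symm z a.1] at h5
      have hr := (hS b (huS hb).1).1
      have h6 : d z x < A * (4 * b.2) := h5.trans_lt (by gcongr; linarith)
      have h7 : A * (d b.1 z + d z x) < A * (b.2 + A * (4 * b.2)) := by gcongr
      show d b.1 x < 5 * A ^ 2 * b.2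
      nlinarith [mul_nonneg (mul_nonneg (zero_le_one.trans hA) (sub_nonneg.2 hA)) hr.le]
    have hsumle : ∀ f : X → ℝ≥0∞, ∑' b : u, ∫⁻ x in d.ball b.1.1 b.1.2, f x ∂μ ≤
        ∫⁻ x, f x ∂μ := fun f => by
      rw [← lintegral_biUnion (s := fun b : X × ℝ => d.ball b.1 b.2) hcount hmeas hdisj]
      exact setLIntegral_le_lintegral _ _
    have := hcount.to_subtype
    calc _ ≤ ∫⁻ x in ⋃ b : u, d.ball b.1.1 (κ₁ * b.1.2), h x ^ q x ∂μ := by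
          rw [Set.iUnion_coe_set u fun b => d.ball b.1.1 (κ₁ * b.1.2)]
          exact lintegral_mono_set hsub
      _ ≤ ∑' b : u, ∫⁻ x in d.ball b.1.1 (κ₁ * b.1.2), h x ^ q x ∂μ := lintegral_iUnion_le _ _
      _ ≤ ∑' b : u, C * (∫⁻ x in d.ball b.1.1 b.1.2, g x ∂μ +
            ∑ i, ∫⁻ x in d.ball b.1.1 b.1.2, F i x ^ pvec i x ∂μ) := by
          refine ENNReal.tsum_le_tsum fun b => ?_
          have hbS := huS b.2
          have hr := (hS b hbS.1).1
          refine hC b.1.1 b.1.2 hr hbS.2 h F (hFn _) (lt_of_le_of_lt ?_ (hlt b hbS.1))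
          exact luxNorm_mono_measure (Measure.restrict_mono
            (d.ball_subset_ball _ (by nlinarith)) le_rfl)
      _ = C * (∑' b : u, ∫⁻ x in d.ball b.1.1 b.1.2, g x ∂μ +
            ∑ i, ∑' b : u, ∫⁻ x in d.ball b.1.1 b.1.2, F i x ^ pvec i x ∂μ) := by
          rw [ENNReal.tsum_mul_left, ENNReal.tsum_add,
            Summable.tsum_finsetSum fun _ _ => ENNReal.summable]
      _ ≤ C * (∫⁻ x, g x ∂μ + ∑ _i : Fin m, 1) := by
          gcongr with i
          · exact hsumle g
          · exact (hsumle _).trans (hF i)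
      _ = _ := by simp
  calc _ ≤ ∫⁻ x in (⋃ b ∈ Sc, d.ball b.1 b.2) ∪ ⋃ b ∈ Sn, d.ball b.1 b.2, h x ^ q x ∂μ :=
        lintegral_mono_set hcov
    _ ≤ _ := (lintegral_union_le _ _ _).trans (add_le_add hcentral hnoncentral)

end Core

section Sufficiency

variable {X : Type*} [MeasurableSpace X] {d : QuasiMetric X} {μ : Measure X}
  {m : ℕ} {η : ℝ} {pvec : Fin m → X → ℝ} {q : X → ℝ} {ω : Fin m → X → ℝ≥0∞}

/-- A bound for the modular gives a bound for the norm. -/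
theorem luxNorm_le_of_modular_le {ν : Measure X} {a : ℝ} (ha : 0 < a) (hq : ∀ᵐ x ∂ν, a < q x)
    {C : ℝ≥0} {h : X → ℝ≥0∞} (hh : ∫⁻ x, h x ^ q x ∂ν ≤ C) :
    luxNorm ν q h ≤ (C + 1 : ℝ≥0∞) ^ (1 / a) := by
  set E : ℝ≥0∞ := (C + 1 : ℝ≥0∞) with hE
  have hE0 : E ≠ 0 := by simp [hE]
  have hEt : E ≠ ∞ := by finiteness
  have h1 : 1 ≤ E ^ (1 / a) := ENNReal.one_le_rpow le_add_self (by positivity)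
  refine luxNorm_le_of_modular_le_one (one_pos.trans_le h1).ne'
    (ENNReal.rpow_ne_top_of_nonneg (by positivity) hEt) ?_
  calc ∫⁻ x, (h x / E ^ (1 / a)) ^ q x ∂ν ≤ ∫⁻ x, h x ^ q x * E⁻¹ ∂ν := by
        refine lintegral_mono_ae ?_
        filter_upwards [hq] with x hx
        rw [ENNReal.div_rpow_of_nonneg _ _ (ha.trans hx).le, div_eq_mul_inv]
        gcongr
        calc E = (E ^ (1 / a)) ^ a := by
              rw [← ENNReal.rpow_mul, one_div_mul_cancel ha.ne', ENNReal.rpow_one]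
          _ ≤ (E ^ (1 / a)) ^ q x := ENNReal.rpow_le_rpow_of_exponent_le h1 hx.le
    _ = (∫⁻ x, h x ^ q x ∂ν) * E⁻¹ := lintegral_mul_const' _ _ (ENNReal.inv_ne_top.2 hE0)
    _ ≤ E * E⁻¹ := by
        gcongr
        exact hh.trans le_self_add
    _ = 1 := ENNReal.mul_inv_cancel hE0 hEt

theorem setOf_lt_fracMaximal (f : Fin m → X → ℝ) (t : ℝ≥0∞) :
    {x | t < fracMaximal d μ η f x} = ⋃ n : ℕ, ⋃ b ∈ {b : X × ℝ | (0 < b.2 ∧ b.2 ≤ n) ∧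
      t < fracAverage μ η f (d.ball b.1 b.2)}, d.ball b.1 b.2 := by
  ext x
  simp only [Set.mem_ofPred_eq, fracMaximal, lt_iSup_iff, Set.mem_iUnion, exists_prop]
  constructor
  · rintro ⟨c, r, hr, hx, ht⟩
    obtain ⟨n, hn⟩ := exists_nat_ge r
    exact ⟨n, (c, r), ⟨⟨hr, hn⟩, ht⟩, hx⟩
  · rintro ⟨n, b, ⟨⟨hr, -⟩, ht⟩, hx⟩
    exact ⟨b.1, b.2, hr, hx, ht⟩

theorem MemA.weakBounded (hX : IsHomogeneousType d μ) (x₀ : X) (hη : 0 ≤ η) (hηm : η < m)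
    (hq : IsExpP0 μ q) (hpvec : ∀ i, IsExpP μ (pvec i)) (hLH : ∀ i, LH d x₀ (pvec i))
    (hsum : ∀ x, 1 / q x = ∑ i, 1 / pvec i x - η) (hω : ∀ i, IsWeight d μ (ω i))
    (hA : MemA d μ η pvec q ω (fun x => ∏ i, ω i x)) :
    WeakBounded d μ η pvec q ω (fun x => ∏ i, ω i x) := by
  obtain ⟨C₀, κ, hκ, hC₀⟩ := exists_setLIntegral_iUnion_ball_le hX x₀ hη hq hpvec hLH hsum
  obtain ⟨D, hD⟩ := hA.exists_luxNorm_ball_le hX hηm hq hpvec hsum hω hκ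
  obtain ⟨a, ha, haq⟩ := hq.exists_lower
  set ω₀ : X → ℝ≥0∞ := fun x => ∏ i, ω i x with hω₀
  set W := weightChar d μ η pvec q ω ω₀ with hW
  have hWt : W ≠ ∞ := hA.ne
  set K₁ : ℝ≥0∞ := D * (2 ^ m * W) with hK₁
  have hK₁t : K₁ ≠ ∞ := by finiteness
  set C₃ : ℝ≥0∞ := (C₀ + 1 : ℝ≥0∞) ^ (1 / a) with hC₃
  have hC₃t : C₃ ≠ ∞ := ENNReal.rpow_ne_top_of_nonneg (by positivity) (by finiteness)
  have hCt : (K₁ + 1) * 4 ^ m * C₃ ≠ ∞ := by finiteness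
  refine ⟨((K₁ + 1) * 4 ^ m * C₃).toNNReal, fun f hf => ?_⟩
  rw [ENNReal.coe_toNNReal hCt]
  refine iSup₂_le fun t ht => ?_
  have ht0 : (t : ℝ≥0∞) ≠ 0 := by exact_mod_cast ht.ne'
  set N : Fin m → ℝ≥0∞ := fun i => wNorm μ (pvec i) (ω i) (f i) with hN
  have hNt : ∀ i, N i ≠ ∞ := fun i => (hf i).2.ne
  have hp0 : ∀ i x, 0 ≤ pvec i x := fun i x => zero_le_one.trans ((hpvec i).one_le x)
  have hloc : ∀ i (B : Set X),
      luxNorm (μ.restrict B) (pvec i) (fun x => ω i x * ‖f i x‖ₑ) ≤ N i := fun i B =>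
    luxNorm_mono_measure Measure.restrict_le_self
  have hball : ∀ (c : X) (r : ℝ), 0 < r → (t : ℝ≥0∞) < fracAverage μ η f (d.ball c r) →
      t * luxNorm (μ.restrict (d.ball c (κ * r))) q ω₀ ≤
        K₁ * ∏ i, luxNorm (μ.restrict (d.ball c r)) (pvec i) (fun x => ω i x * ‖f i x‖ₑ) := by
    intro c r hr hlt
    calc _ ≤ fracAverage μ η f (d.ball c r) *
          (D * luxNorm (μ.restrict (d.ball c r)) q ω₀) := by
          gcongr
          exact hD c r hr
      _ = D * (fracAverage μ η f (d.ball c r) * luxNorm (μ.restrict (d.ball c r)) q ω₀) := by ring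
      _ ≤ D * (2 ^ m * W * ∏ i, luxNorm (μ.restrict (d.ball c r)) (pvec i)
            (fun x => ω i x * ‖f i x‖ₑ)) :=
          mul_le_mul_right
            (hA.fracAverage_mul_luxNorm_le hX hq hpvec hω (fun i => (hf i).1) c hr) _
      _ = _ := by rw [hK₁]; ring
  have hpos : ∀ (c : X) (r : ℝ), 0 < r → (t : ℝ≥0∞) < fracAverage μ η f (d.ball c r) →
      ∏ i, luxNorm (μ.restrict (d.ball c r)) (pvec i) (fun x => ω i x * ‖f i x‖ₑ) ≠ 0 := by
    intro c r hr hlt h0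
    have h1 := hball c r hr hlt
    rw [h0, mul_zero, nonpos_iff_eq_zero] at h1
    exact mul_ne_zero ht0 (luxNorm_weight_pos hX hq hω c (by positivity)).ne' h1
  by_cases hN0 : ∃ i, N i = 0
  · obtain ⟨i, hi⟩ := hN0
    have hempty : {x | (t : ℝ≥0∞) < fracMaximal d μ η f x} = ∅ := by
      rw [setOf_lt_fracMaximal]
      refine Set.eq_empty_of_forall_notMem fun x hx => ?_
      simp only [Set.mem_iUnion] at hx
      obtain ⟨n, b, ⟨⟨hr, -⟩, hlt⟩, -⟩ := hx
      refine hpos b.1 b.2 hr hlt (Finset.prod_eq_zero (Finset.mem_univ i) ?_)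
      exact nonpos_iff_eq_zero.1 (hi ▸ hloc i _)
    rw [hempty]
    refine le_trans (le_of_eq ?_) bot_le
    refine le_antisymm (ENNReal.le_of_forall_pos_le_add fun ε hε _ => ?_) bot_le
    rw [bot_eq_zero, zero_add]
    exact luxNorm_le_of_modular_le_one (by exact_mod_cast hε.ne') (by simp) (by simp)
  push Not at hN0
  set Q : ℝ≥0∞ := (K₁ + 1) * ∏ i, (4 * N i) with hQ
  have hP0 : ∏ i, (4 * N i) ≠ 0 :=
    Finset.prod_ne_zero_iff.2 fun i _ => mul_ne_zero (by simp) (hN0 i)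
  have hQ0 : Q ≠ 0 := mul_ne_zero (by simp) hP0
  have hPt : ∏ i, (4 * N i) ≠ ∞ :=
    (ENNReal.prod_lt_top fun i _ => ENNReal.mul_lt_top (by simp) (hNt i).lt_top).ne
  have hQt : Q ≠ ∞ := ENNReal.mul_ne_top (by finiteness) hPt
  set s : ℝ≥0∞ := t / Q with hs
  have hs0 : s ≠ 0 := (ENNReal.div_pos ht0 hQt).ne'
  have hst : s ≠ ∞ := ENNReal.div_ne_top (by simp) hQ0
  have h2N0 : ∀ i, (2 * N i)⁻¹ ≠ 0 := fun i =>
    ENNReal.inv_ne_zero.2 (ENNReal.mul_ne_top (by simp) (hNt i))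
  have h2Nt : ∀ i, (2 * N i)⁻¹ ≠ ∞ := fun i =>
    ENNReal.inv_ne_top.2 (mul_ne_zero (by simp) (hN0 i))
  have key := hC₀ (fun x => s * ω₀ x) (fun i x => (2 * N i)⁻¹ * (ω i x * ‖f i x‖ₑ)) (by
    intro i
    have h1 : N i < 2 * N i := by
      rw [two_mul]
      exact ENNReal.lt_add_right (hNt i) (hN0 i)
    have h2 := modular_le_one_of_luxNorm_lt (ae_of_all μ (hp0 i)) h1
    simpa only [ENNReal.div_eq_inv_mul] using h2)
  have hS : ∀ n : ℕ, ∫⁻ x in ⋃ b ∈ {b : X × ℝ | (0 < b.2 ∧ b.2 ≤ n) ∧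
      (t : ℝ≥0∞) < fracAverage μ η f (d.ball b.1 b.2)}, d.ball b.1 b.2,
        (s * ω₀ x) ^ q x ∂μ ≤ C₀ := by
    intro n
    refine key _ n (fun b hb => hb.1) fun b hb => ?_
    have hr := hb.1.1
    have h1 := hball b.1 b.2 hr hb.2
    have h0 := hpos b.1 b.2 hr hb.2
    simp only [luxNorm_const_mul hs0 hst, luxNorm_const_mul (h2N0 _) (h2Nt _)]
    set V : Fin m → ℝ≥0∞ := fun i =>
      luxNorm (μ.restrict (d.ball b.1 b.2)) (pvec i) (fun x => ω i x * ‖f i x‖ₑ) with hV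
    have hVt : ∏ i, V i ≠ ∞ := (ENNReal.prod_lt_top fun i _ => (hloc i _).trans_lt
      (hNt i).lt_top).ne
    have e1 : ∏ i, (2 * N i)⁻¹ * V i / 2 = (∏ i, V i) / ∏ i, (4 * N i) := by
      rw [div_eq_mul_inv (∏ i, V i), ENNReal.prod_inv_distrib
        fun i _ j _ _ => Or.inl (mul_ne_zero (by simp) (hN0 i)), ← Finset.prod_mul_distrib]
      refine Finset.prod_congr rfl fun i _ => ?_
      have e2 : (4 * N i)⁻¹ = 2⁻¹ * (2 * N i)⁻¹ := by
        rw [← ENNReal.mul_inv (by simp) (by simp), ← mul_assoc]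
        norm_num
      rw [e2, div_eq_mul_inv]
      ring
    rw [e1, ENNReal.lt_div_iff_mul_lt (Or.inl hP0) (Or.inl hPt)]
    have h2 : t * luxNorm (μ.restrict (d.ball b.1 (κ * b.2))) q ω₀ < (K₁ + 1) * ∏ i, V i := by
      refine h1.trans_lt ?_
      rw [add_mul, one_mul]
      exact ENNReal.lt_add_right (ENNReal.mul_ne_top hK₁t hVt) h0
    have h3 : s * luxNorm (μ.restrict (d.ball b.1 (κ * b.2))) q ω₀ * ∏ i, (4 * N i) =
        t * luxNorm (μ.restrict (d.ball b.1 (κ * b.2))) q ω₀ / (K₁ + 1) := by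
      rw [hs, hQ, div_eq_mul_inv, ENNReal.mul_inv (by simp) (Or.inr hP0)]
      have h4 : (∏ i, (4 * N i))⁻¹ * ∏ i, (4 * N i) = 1 := ENNReal.inv_mul_cancel hP0 hPt
      calc _ = t * luxNorm (μ.restrict (d.ball b.1 (κ * b.2))) q ω₀ * (K₁ + 1)⁻¹ *
            ((∏ i, (4 * N i))⁻¹ * ∏ i, (4 * N i)) := by ring
        _ = _ := by rw [h4, mul_one, div_eq_mul_inv]
    rw [h3]
    exact ENNReal.div_lt_of_lt_mul (h2.trans_eq (mul_comm _ _))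
  have hmod : ∫⁻ x in {x | (t : ℝ≥0∞) < fracMaximal d μ η f x}, (s * ω₀ x) ^ q x ∂μ ≤ C₀ := by
    rw [setOf_lt_fracMaximal, setLIntegral_iUnion_of_directed]
    · exact iSup_le hS
    · refine Monotone.directed_le fun n k hnk => ?_
      refine Set.biUnion_subset_biUnion_left fun b hb => ⟨⟨hb.1.1, hb.1.2.trans ?_⟩, hb.2⟩
      exact_mod_cast hnk
  have hlux := luxNorm_le_of_modular_le ha (ae_restrict_of_ae haq) hmod
  rw [luxNorm_const_mul hs0 hst] at hlux
  rw [luxNorm_const_mul ht0 (by simp)]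
  have hts : (t : ℝ≥0∞) = Q * s := by rw [hs, ENNReal.mul_div_cancel hQ0 hQt]
  calc _ = Q * (s * luxNorm (μ.restrict {x | (t : ℝ≥0∞) < fracMaximal d μ η f x}) q ω₀) := by
        rw [hts]; ring
    _ ≤ Q * C₃ := by gcongr
    _ = _ := by
        rw [hQ, Finset.prod_mul_distrib]
        simp only [Finset.prod_const, Finset.card_univ, Fintype.card_fin]
        ring

end Sufficiency

section Duality

variable {X : Type*} [MeasurableSpace X] {μ ν : Measure X} {p : X → ℝ}

/-- The Luxemburg norm is lower semicontinuous along truncations. -/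
theorem exists_lt_luxNorm_min {r : X → ℝ} (hrm : Measurable r) (hr : ∀ᵐ x ∂ν, 0 < r x)
    {g : X → ℝ≥0∞} (hg : AEMeasurable g ν) {L : ℝ≥0∞} (hL : L < luxNorm ν r g) :
    ∃ n : ℕ, L < luxNorm ν r (fun x => min (g x) n) := by
  by_contra! hc
  refine absurd (le_of_forall_gt_imp_ge_of_dense fun s hs => ?_) (not_le.2 hL)
  by_cases hst : s = ∞
  · simp [hst]
  have hs0 : s ≠ 0 := (bot_le.trans_lt hs).ne'
  refine luxNorm_le_of_modular_le_one hs0 hst ?_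
  have hmono : ∀ᵐ x ∂ν, Monotone fun n : ℕ => (min (g x) n / s) ^ r x := by
    filter_upwards [hr] with x hx n k hnk
    have : (n : ℝ≥0∞) ≤ k := by exact_mod_cast hnk
    exact ENNReal.rpow_le_rpow (by gcongr) hx.le
  have hsup : ∀ᵐ x ∂ν, (g x / s) ^ r x = ⨆ n : ℕ, (min (g x) n / s) ^ r x := by
    filter_upwards [hr, hmono] with x hx hmx
    refine (iSup_eq_of_tendsto hmx ?_).symm
    have h1 : Filter.Tendsto (fun n : ℕ => min (g x) (n : ℝ≥0∞)) Filter.atTop (nhds (g x)) := by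
      simpa using (tendsto_const_nhds (x := g x)).min ENNReal.tendsto_nat_nhds_top
    exact ((ENNReal.continuous_rpow_const (y := r x)).tendsto _).comp
      (ENNReal.Tendsto.div_const h1 (Or.inr hs0))
  rw [lintegral_congr_ae hsup, lintegral_iSup'
    (fun n => ((hg.min aemeasurable_const).div_const _).pow hrm.aemeasurable) hmono]
  exact iSup_le fun n => modular_le_one_of_luxNorm_lt (hr.mono fun x hx => hx.le)
    ((hc n).trans_lt hs)

theorem luxNorm_lt_top_of_le_nat [IsFiniteMeasure ν] {r : X → ℝ} (hr : ∀ᵐ x ∂ν, 1 ≤ r x)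
    {g : X → ℝ≥0∞} {n : ℕ} (hg : ∀ x, g x ≤ n) : luxNorm ν r g < ∞ := by
  set V : ℝ≥0∞ := ν Set.univ + 1 with hV
  have hV0 : V ≠ 0 := by simp [hV]
  have hVt : V ≠ ∞ := by finiteness
  have hn0 : (n + 1 : ℝ≥0∞) ≠ 0 := by simp
  have hR : (n + 1 : ℝ≥0∞) * V ≠ ∞ := by finiteness
  refine (luxNorm_le_of_modular_le_one (mul_ne_zero hn0 hV0) hR ?_).trans_lt hR.lt_top
  calc ∫⁻ x, (g x / ((n + 1) * V)) ^ r x ∂ν ≤ ∫⁻ _, V⁻¹ ∂ν := by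
        refine lintegral_mono_ae ?_
        filter_upwards [hr] with x hx
        have h1 : g x / ((n + 1) * V) ≤ V⁻¹ := by
          refine ENNReal.div_le_of_le_mul ?_
          rw [mul_comm, mul_assoc, ENNReal.mul_inv_cancel hV0 hVt, mul_one]
          exact (hg x).trans le_self_add
        have h2 : V⁻¹ ≤ 1 := ENNReal.inv_le_one.2 le_add_self
        calc _ ≤ V⁻¹ ^ r x := ENNReal.rpow_le_rpow h1 (zero_le_one.trans hx)
          _ ≤ V⁻¹ ^ (1 : ℝ) := ENNReal.rpow_le_rpow_of_exponent_ge h2 hx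
          _ = V⁻¹ := ENNReal.rpow_one _
    _ = V⁻¹ * ν Set.univ := lintegral_const _
    _ ≤ V⁻¹ * V := by
        gcongr
        exact le_self_add
    _ = 1 := ENNReal.inv_mul_cancel hV0 hVt

theorem one_lt_conjExponent {a : ℝ} (ha : 1 < a) : 1 < a.conjExponent :=
  (Real.HolderConjugate.conjExponent ha).symm.lt

/-- Norming functions for the Luxemburg norm of the conjugate exponent. -/
theorem exists_norming [IsFiniteMeasure ν] (hpm : Measurable p) (hp : ∀ᵐ x ∂ν, 1 < p x) {b : ℝ}
    (hb : ∀ᵐ x ∂ν, (p x).conjExponent ≤ b) {g : X → ℝ≥0∞} (hg : AEMeasurable g ν) {L : ℝ≥0∞}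
    (hL : L < luxNorm ν (fun x => (p x).conjExponent) g) :
    ∃ h : X → ℝ≥0∞, AEMeasurable h ν ∧ (∀ᵐ x ∂ν, h x < ∞) ∧ ∫⁻ x, h x ^ p x ∂ν ≤ 1 ∧
      (4 ^ b)⁻¹ * L ≤ ∫⁻ x, h x * g x ∂ν := by
  have hrm : Measurable fun x => (p x).conjExponent := hpm.div (hpm.sub_const 1)
  have hr1 : ∀ᵐ x ∂ν, 1 < (p x).conjExponent := hp.mono fun x hx => one_lt_conjExponent hx
  have hr0 : ∀ᵐ x ∂ν, 0 < (p x).conjExponent := hr1.mono fun x hx => one_pos.trans hx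
  obtain ⟨n, hn⟩ := exists_lt_luxNorm_min hrm hr0 hg hL
  set gn : X → ℝ≥0∞ := fun x => min (g x) n with hgn
  have hgnm : AEMeasurable gn ν := hg.min aemeasurable_const
  set B := luxNorm ν (fun x => (p x).conjExponent) gn with hB
  have hB0 : B ≠ 0 := (bot_le.trans_lt hn).ne'
  have hBt : B ≠ ∞ := (luxNorm_lt_top_of_le_nat (hr1.mono fun x hx => hx.le)
    (fun x => min_le_right _ _)).ne
  have h2B0 : 2 * B ≠ 0 := mul_ne_zero (by simp) hB0
  have h2Bt : 2 * B ≠ ∞ := ENNReal.mul_ne_top (by simp) hBt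
  have hle := modular_le_one_of_luxNorm_lt (hr0.mono fun x hx => hx.le)
    (show B < 2 * B by rw [two_mul]; exact ENNReal.lt_add_right hBt hB0)
  have hge := one_lt_modular_of_lt_luxNorm (ENNReal.half_pos hB0).ne'
    (ENNReal.half_lt_self hB0 hBt)
  refine ⟨fun x => (gn x / (2 * B)) ^ ((p x).conjExponent - 1),
    (hgnm.div_const _).pow (hrm.sub_const 1).aemeasurable, ?_, ?_, ?_⟩
  · filter_upwards [hr1] with x hx
    refine ENNReal.rpow_lt_top_of_nonneg (by linarith) (ENNReal.div_ne_top ?_ h2B0)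
    exact ne_top_of_le_ne_top (ENNReal.natCast_ne_top n) (min_le_right _ _)
  · refine le_trans (le_of_eq (lintegral_congr_ae ?_)) hle
    filter_upwards [hp] with x hx
    rw [← ENNReal.rpow_mul]
    congr 1
    rw [Real.conjExponent]
    have : p x - 1 ≠ 0 := by linarith
    field_simp
    ring
  · calc (4 ^ b)⁻¹ * L ≤ 2 * B * ((4 ^ b)⁻¹ * 1) := by
          rw [mul_one, mul_comm]
          gcongr
          exact hn.le.trans (le_mul_of_one_le_left' one_le_two)
      _ ≤ 2 * B * ((4 ^ b)⁻¹ * ∫⁻ x, (gn x / (B / 2)) ^ (p x).conjExponent ∂ν) := by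
          gcongr
      _ = 2 * B * ∫⁻ x, (4 ^ b)⁻¹ * (gn x / (B / 2)) ^ (p x).conjExponent ∂ν := by
          rw [lintegral_const_mul' _ _ (ENNReal.inv_ne_top.2 ?_)]
          exact (ENNReal.rpow_pos (by simp) (by simp)).ne'
      _ ≤ 2 * B * ∫⁻ x, (gn x / (2 * B)) ^ (p x).conjExponent ∂ν := by
          refine mul_le_mul_right (lintegral_mono_ae ?_) _
          filter_upwards [hr0, hb] with x hx hbx
          have e : gn x / (B / 2) = 4 * (gn x / (2 * B)) := by
            have e4 : (4 : ℝ≥0∞) = 2 * 2 := by norm_num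
            have e2 : (2 : ℝ≥0∞) * 2⁻¹ = 1 := ENNReal.mul_inv_cancel (by simp) (by simp)
            rw [e4]
            simp only [div_eq_mul_inv]
            rw [ENNReal.mul_inv (by simp) (by simp), ENNReal.mul_inv (by simp) (by simp), inv_inv]
            calc gn x * (B⁻¹ * 2) = gn x * (B⁻¹ * 2) * 1 := by rw [mul_one]
              _ = _ := by rw [← e2]; ring
          rw [e, ENNReal.mul_rpow_of_nonneg _ _ hx.le, ← mul_assoc]
          refine mul_le_of_le_one_left' ?_
          rw [← ENNReal.div_eq_inv_mul]
          refine ENNReal.div_le_of_le_mul ?_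
          rw [one_mul]
          exact ENNReal.rpow_le_rpow_of_exponent_le (by norm_num) hbx
      _ = ∫⁻ x, 2 * B * (gn x / (2 * B)) ^ (p x).conjExponent ∂ν :=
          (lintegral_const_mul' _ _ h2Bt).symm
      _ ≤ _ := by
          refine lintegral_mono_ae ?_
          filter_upwards [hr1] with x hx
          have e : (gn x / (2 * B)) ^ (p x).conjExponent =
              (gn x / (2 * B)) ^ ((p x).conjExponent - 1) * (gn x / (2 * B)) := by
            conv_lhs => rw [← sub_add_cancel (p x).conjExponent 1]
            rw [ENNReal.rpow_add_of_nonneg _ _ (by linarith) zero_le_one, ENNReal.rpow_one]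
          rw [e]
          calc _ = (gn x / (2 * B)) ^ ((p x).conjExponent - 1) * (2 * B * (gn x / (2 * B))) := by
                ring
            _ = (gn x / (2 * B)) ^ ((p x).conjExponent - 1) * gn x := by
                rw [ENNReal.mul_div_cancel h2B0 h2Bt]
            _ ≤ _ := by
                gcongr
                exact min_le_left _ _

/-- Test functions for the weighted space that norm the inverse weight. -/
theorem IsExpP.exists_test_function (hp : IsExpP μ p) :
    ∃ a : ℝ≥0, 0 < a ∧ ∀ (B : Set X), MeasurableSet B → μ B < ∞ → ∀ ω : X → ℝ≥0∞,
      AEMeasurable ω μ → (∀ᵐ x ∂μ, 0 < ω x ∧ ω x < ∞) →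
      ∀ L < luxNorm (μ.restrict B) (fun x => (p x).conjExponent) (fun x => (ω x)⁻¹),
      ∃ f : X → ℝ, AEMeasurable f μ ∧ wNorm μ p ω f ≤ 1 ∧ a * L ≤ ∫⁻ x in B, ‖f x‖ₑ ∂μ := by
  obtain ⟨b, hb1, hb⟩ := hp.exists_conj_upper
  obtain ⟨l, hl1, hl⟩ := hp.exists_lower
  have ht : ((4 : ℝ≥0∞) ^ b)⁻¹ ≠ ∞ :=
    ENNReal.inv_ne_top.2 (ENNReal.rpow_pos (by simp) (by simp)).ne'
  have h0 : ((4 : ℝ≥0∞) ^ b)⁻¹ ≠ 0 :=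
    ENNReal.inv_ne_zero.2 (ENNReal.rpow_ne_top_of_nonneg (by linarith) (by simp))
  refine ⟨((4 : ℝ≥0∞) ^ b)⁻¹.toNNReal, ENNReal.toNNReal_pos h0 ht, ?_⟩
  intro B hBm hBt ω hωm hω L hL
  rw [ENNReal.coe_toNNReal ht]
  have : IsFiniteMeasure (μ.restrict B) := ⟨by simpa using hBt⟩
  obtain ⟨h, hhm, hht, hh1, hhL⟩ := exists_norming hp.measurable
    (ae_restrict_of_ae (hl.mono fun x hx => hl1.trans hx)) (ae_restrict_of_ae hb)
    hωm.inv.restrict hL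
  have hfin : ∀ᵐ x ∂μ.restrict B, ‖(h x * (ω x)⁻¹).toReal‖ₑ = h x * (ω x)⁻¹ := by
    filter_upwards [hht, ae_restrict_of_ae hω] with x hx hωx
    rw [Real.enorm_of_nonneg ENNReal.toReal_nonneg, ENNReal.ofReal_toReal]
    exact ENNReal.mul_ne_top hx.ne (ENNReal.inv_ne_top.2 hωx.1.ne')
  refine ⟨B.indicator fun x => (h x * (ω x)⁻¹).toReal, ?_, ?_, ?_⟩
  · rw [aemeasurable_indicator_iff hBm]
    exact (hhm.mul hωm.inv.restrict).ennreal_toReal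
  · refine luxNorm_le_of_modular_le_one one_ne_zero ENNReal.one_ne_top ?_
    refine le_trans (le_of_eq ?_) hh1
    rw [← lintegral_indicator hBm]
    refine lintegral_congr_ae ?_
    filter_upwards [(ae_restrict_iff' hBm).1 hfin, hω] with x hx hωx
    by_cases hxB : x ∈ B
    · simp only [Set.indicator_of_mem hxB, hx hxB, div_one]
      congr 1
      rw [mul_comm, mul_assoc, ENNReal.inv_mul_cancel hωx.1.ne' hωx.2.ne, mul_one]
    · simp only [Set.indicator_of_notMem hxB, enorm_zero, mul_zero, div_one]
      exact ENNReal.zero_rpow_of_pos (one_pos.trans_le (hp.one_le x))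
  · refine hhL.trans (le_of_eq (lintegral_congr_ae ?_))
    filter_upwards [hfin, ae_restrict_mem hBm] with x hx hxB
    simp only [Set.indicator_of_mem hxB, hx, Pi.inv_apply]

end Duality

theorem mul_prod_le_of_forall_lt {ι : Type*} (s : Finset ι) (b : ι → ℝ≥0∞) {C : ℝ≥0∞} :
    ∀ K : ℝ≥0∞, (∀ L : ι → ℝ≥0∞, (∀ i ∈ s, L i < b i) → K * ∏ i ∈ s, L i ≤ C) →
      K * ∏ i ∈ s, b i ≤ C := by
  classical
  induction s using Finset.induction_on with
  | empty => intro K h; simpa using h 0 (by simp)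
  | insert j s hj ih =>
    intro K h
    rw [Finset.prod_insert hj, ← mul_assoc]
    refine ih _ fun L hL => ?_
    rw [mul_right_comm]
    refine ENNReal.mul_le_of_forall_lt fun a' ha b' hb => ?_
    have h1 := h (Function.update L j b') (by
      intro i hi
      rcases Finset.mem_insert.1 hi with rfl | his
      · simpa using hb
      · rw [Function.update_of_ne (by rintro rfl; exact hj his)]
        exact hL i his)
    rw [Finset.prod_insert hj, Function.update_self,
      Finset.prod_congr rfl fun i hi => Function.update_of_ne
        (by rintro rfl; exact hj hi : i ≠ j) b' L] at h1
    calc a' * b' ≤ (K * ∏ i ∈ s, L i) * b' := by gcongr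
      _ = K * (b' * ∏ i ∈ s, L i) := by ring
      _ ≤ C := h1

section Necessity

variable {X : Type*} [MeasurableSpace X] {d : QuasiMetric X} {μ : Measure X}
  {m : ℕ} {η : ℝ} {pvec : Fin m → X → ℝ} {q : X → ℝ}

theorem WeakBoundWith.fracAverage_mul_luxNorm_le {ω : Fin m → X → ℝ≥0∞} {ω₀ : X → ℝ≥0∞} {C : ℝ≥0}
    (h : WeakBoundWith d μ η pvec q ω ω₀ C) {f : Fin m → X → ℝ}
    (hf : ∀ i, AEMeasurable (f i) μ) (hf1 : ∀ i, wNorm μ (pvec i) (ω i) (f i) ≤ 1)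
    (c : X) {r : ℝ} (hr : 0 < r) :
    fracAverage μ η f (d.ball c r) * luxNorm (μ.restrict (d.ball c r)) q ω₀ ≤ C := by
  refine ENNReal.mul_le_of_forall_lt fun t ht s hs => ?_
  rcases eq_or_ne t 0 with rfl | ht0
  · simp
  have htt : t ≠ ∞ := ht.ne_top
  lift t to ℝ≥0 using htt
  have hsub : d.ball c r ⊆ {x | (t : ℝ≥0∞) < fracMaximal d μ η f x} := fun x hx =>
    ht.trans_le (le_iSup_of_le c (le_iSup_of_le r (le_iSup_of_le hr (le_iSup_of_le hx le_rfl))))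
  calc (t : ℝ≥0∞) * s ≤ t * luxNorm (μ.restrict (d.ball c r)) q ω₀ := by gcongr
    _ = luxNorm (μ.restrict (d.ball c r)) q (fun x => t * ω₀ x) :=
        (luxNorm_const_mul ht0 (by simp)).symm
    _ ≤ luxNorm (μ.restrict {x | (t : ℝ≥0∞) < fracMaximal d μ η f x}) q (fun x => t * ω₀ x) :=
        luxNorm_mono_measure (Measure.restrict_mono hsub le_rfl)
    _ ≤ weakNorm μ q ω₀ (fracMaximal d μ η f) :=
        le_iSup₂_of_le t (pos_iff_ne_zero.2 (by exact_mod_cast ht0)) le_rfl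
    _ ≤ C * ∏ i, wNorm μ (pvec i) (ω i) (f i) :=
        h f fun i => ⟨hf i, (hf1 i).trans_lt ENNReal.one_lt_top⟩
    _ ≤ C := mul_le_of_le_one_right' (Finset.prod_le_one' fun i _ => hf1 i)

theorem exists_weightChar_le_mul_weakOpNorm (hX : IsHomogeneousType d μ)
    (hpvec : ∀ i, IsExpP μ (pvec i)) :
    ∃ C : ℝ≥0, 0 < C ∧ ∀ ω : Fin m → X → ℝ≥0∞, (∀ i, IsWeight d μ (ω i)) → ∀ ω₀ : X → ℝ≥0∞,
      weightChar d μ η pvec q ω ω₀ ≤ C * weakOpNorm d μ η pvec q ω ω₀ := by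
  choose a ha hfun using fun i => (hpvec i).exists_test_function
  have hP : 0 < ∏ i, a i := Finset.prod_pos fun i _ => ha i
  have hP0 : ((∏ i, a i : ℝ≥0) : ℝ≥0∞) ≠ 0 := by exact_mod_cast hP.ne'
  refine ⟨(∏ i, a i)⁻¹, inv_pos.2 hP, fun ω hω ω₀ => ?_⟩
  rw [ENNReal.coe_inv hP.ne', ← ENNReal.div_eq_inv_mul,
    ENNReal.le_div_iff_mul_le (Or.inl hP0) (Or.inl ENNReal.coe_ne_top)]
  refine le_iInf₂ fun C hC => ?_
  rw [← ENNReal.le_div_iff_mul_le (Or.inl hP0) (Or.inl ENNReal.coe_ne_top)]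
  refine iSup_le fun c => iSup₂_le fun r hr => ?_
  refine mul_prod_le_of_forall_lt _ _ _ fun L hL => ?_
  rw [ENNReal.le_div_iff_mul_le (Or.inl hP0) (Or.inl ENNReal.coe_ne_top)]
  have hμ0 := (hX.measure_ball_pos c hr).ne'
  have hμt := hX.measure_ball_lt_top c hr
  choose f hfm hf1 hfL using fun i => hfun i (d.ball c r) (hX.measurableSet_ball c hr) hμt (ω i)
    (hω i).aemeasurable (hω i).pos_finite (L i) (hL i (Finset.mem_univ i))
  refine le_trans ?_ (hC.fracAverage_mul_luxNorm_le hfm hf1 c hr)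
  rw [fracAverage_eq η f hμ0 hμt.ne]
  calc _ = μ (d.ball c r) ^ (η - (m : ℝ)) * (∏ i, (a i : ℝ≥0∞) * L i) *
        luxNorm (μ.restrict (d.ball c r)) q ω₀ := by
        rw [Finset.prod_mul_distrib, ENNReal.ofNNReal_finsetProd]
        ring
    _ ≤ _ := by
        gcongr with i
        exact hfL i

end Necessity

end VarWeights

theorem theorem1p4 {X : Type*} [MeasurableSpace X] (d : QuasiMetric X) (μ : Measure X)
    (hX : IsHomogeneousType d μ) (x₀ : X)
    (m : ℕ) (η : ℝ) (hη : 0 ≤ η) (hηm : η < m)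
    (pvec : Fin m → X → ℝ) (p q : X → ℝ)
    (hpvec : ∀ i, IsExpP μ (pvec i)) (hLH : ∀ i, LH d x₀ (pvec i))
    (hp : ∀ x, 1 / p x = ∑ i, 1 / pvec i x)
    (hq : IsExpP0 μ q) (hpq : ∀ x, 1 / p x - 1 / q x = η) :
    (∀ ω : Fin m → X → ℝ≥0∞, (∀ i, IsWeight d μ (ω i)) →
      (WeakBounded d μ η pvec q ω (fun x => ∏ i, ω i x) ↔
        MemA d μ η pvec q ω (fun x => ∏ i, ω i x))) ∧
    (∃ C : ℝ≥0, 0 < C ∧ ∀ ω : Fin m → X → ℝ≥0∞, (∀ i, IsWeight d μ (ω i)) →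
      weightChar d μ η pvec q ω (fun x => ∏ i, ω i x) ≤
        C * weakOpNorm d μ η pvec q ω (fun x => ∏ i, ω i x)) ∧
    (∀ ω : Fin m → X → ℝ≥0∞, (∀ i, IsWeight d μ (ω i)) →
      MemA d μ η pvec q ω (fun x => ∏ i, ω i x) →
        weakOpNorm d μ η pvec q ω (fun x => ∏ i, ω i x) < ∞) := by
  have hsum : ∀ x, 1 / q x = ∑ i, 1 / pvec i x - η := fun x => by
    rw [← hp x, ← hpq x]
    ring
  have hlt : ∀ ω : Fin m → X → ℝ≥0∞, WeakBounded d μ η pvec q ω (fun x => ∏ i, ω i x) →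
      weakOpNorm d μ η pvec q ω (fun x => ∏ i, ω i x) < ∞ := fun ω ⟨C, hC⟩ =>
    (iInf₂_le C hC).trans_lt ENNReal.coe_lt_top
  obtain ⟨C, hC0, hC⟩ := exists_weightChar_le_mul_weakOpNorm (η := η) (q := q) hX hpvec
  refine ⟨fun ω hω => ⟨fun h => ?_, fun h => ?_⟩, ⟨C, hC0, fun ω hω => hC ω hω _⟩,
    fun ω hω h => ?_⟩
  · exact (hC ω hω _).trans_lt (ENNReal.mul_lt_top ENNReal.coe_lt_top (hlt ω h))
  · exact h.weakBounded hX x₀ hη hηm hq hpvec hLH hsum hω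
  · exact hlt ω (h.weakBounded hX x₀ hη hηm hq hpvec hLH hsum hω)
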